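/- Let $\mathcal P=[0,1)\cup i\mathbb R^{+}$, with $i\mathbb R^+=\{i\alpha:\alpha>0\}$. For $\mu\in\mathcal P\setminus\{0\}$ use spheroidal coordinates on $\mathbb R^3$, $$x_0=\mu\cos u\cosh v,\quad x_1=\mu\sin u\sinh v\cos\phi,\quad x_2=\mu\sin u\sinh v\sin\phi,\qquad 0\le u\le\pi,$$ where $v\ge0$ is real if $0<\mu<1$, and $v=w-i\pi/2$ with $w\ge 0$ if $\mu\in i\mathbb R^+$. Let $P_n^m$ be the associated Legendre functions of the first kind, $P_n^m(t)=(-1)^m(1-t^2)^{m/2}\frac{d^m}{dt^m}P_n(t)$ for $-1\le t\le1$ and $P_n^m(\cosh v)=(\sinh v)^m P_n^{(m)}(\cosh v)$; let $(a)_n=a(a+1)\cdots(a+n-1)$, $(a)_0=1$, and $\Phi_m^+(\phi)=\cos m\phi$, $\Phi_m^-(\phi)=\sin m\phi$. For $0\le m\le n$ let $$U_{n,m}^{\pm}[\mu](x)=\frac{(n-m)!}{2^n(1/2)_n}\,\mu^n P_n^m(\cos u)\,P_n^m(\cosh v)\,\Phi_m^\pm(\phi)\quad(\mu\ne0),\qquad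 U_{n,m}^\pm[0](x)=|x|^nP_n^m(x_0/|x|)\,\Phi_m^\pm(\phi),$$ where $\phi$ is the azimuth of $x$ about the $x_0$-axis and the sign $-$ is considered only for $m\ge1$, and let $V_{n,m}^{\pm}[\mu]=\partial U_{n+1,m}^\pm[\mu]/\partial x_0$ (Garabedian spheroidal harmonics). Put $$U_{n,m,k}=\frac{(1/2)_{n-k}\,(n+m-2k+1)_{2k}}{(-4)^k(1/2)_n\,k!},\qquad U^0_{n,m,k}=\frac{4^{n-2k}(2n-4k+1)(n-k)!\,(m+n)!\,(1/2)_{n-2k}}{k!\,(2n-2k+1)!\,(n+m-2k)!}\qquad(0\le m\le n,\ 0\le 2k\le n),$$ $$u_{n,m,k}=(n+m-2k+1)\,U_{n+1,m,k},\qquad u^0_{n,m,k}=\frac{U^0_{n+1,m,k}}{n+m+1}.$$ Let $n\ge0$ and $0\le m\le n$. For all $\tilde\mu,\mu\in\mathcal P$ there are unique coefficients $v_{n,m,k}[\tilde\mu,\mu]$, $0\le 2k\le n-m$, the same for both signs, such that on $\mathbb R^3$ $$V_{n,m}^\pm[\tilde\mu]=\sum_{0\le 2k\le n-m}v_{n,m,k}[\tilde\mu,\mu]\,V_{n-2k,m}^\pm[\mu].$$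 For every $k$ with $0\le2k\le n-m$ the following limits, taken within $\mathcal P\setminus\{0\}$, exist, and they equal the conversion coefficients at parameter $0$: $$\lim_{\tilde\mu\to0}v_{n,m,k}[\tilde\mu,\mu]=v_{n,m,k}[0,\mu]=(n+m+1)\,u^0_{n,m,k}\,\mu^{2k}\qquad(\mu\in\mathcal P),$$ $$\lim_{\mu\to0}v_{n,m,k}[\tilde\mu,\mu]=v_{n,m,k}[\tilde\mu,0]=\frac{u_{n,m,k}}{n+m-2k+1}\,\tilde\mu^{2k}\qquad(\tilde\mu\in\mathcal P).$$ -/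

import Mathlib

namespace Spheroidal

open Polynomial

noncomputable section

/-- The set `[0,1) ∪ iℝ⁺` of admissible parameters: the unit ball (`μ = 0`), the prolate spheroids
(`0 < μ < 1`) and the oblate spheroids (`μ = iα`, `α > 0`). -/
def params : Set ℂ :=
  {μ | (μ.im = 0 ∧ 0 ≤ μ.re ∧ μ.re < 1) ∨ (μ.re = 0 ∧ 0 < μ.im)}

/-- The rising factorial `(1/2)_n`. -/
def halfPoch (n : ℕ) : ℚ := (ascPochhammer ℚ n).eval (1 / 2)

/-- The `m`-th derivative of the Legendre polynomial `P_n = (2ⁿ n!)⁻¹ dⁿ/dXⁿ (X² - 1)ⁿ`. -/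
def legendreDeriv (n m : ℕ) : ℚ[X] :=
  derivative^[m] (C (1 / ((2 : ℚ) ^ n * n.factorial)) * derivative^[n] ((X ^ 2 - 1) ^ n))

/-- The associated Legendre function `P_n^m(t)` on the cut `-1 ≤ t ≤ 1`, in the convention with
the factor `(-1)^m`. -/
def assocLegendreCut (n m : ℕ) (t : ℝ) : ℝ :=
  (-1) ^ m * Real.sqrt (1 - t ^ 2) ^ m * aeval t (legendreDeriv n m)

/-- The associated Legendre function `P_n^m(z) = (z² - 1)^{m/2} P_n^{(m)}(z)` off the cut, at the
point `z = cosh v`, the square root of `z² - 1` being `sinh v`. -/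
def assocLegendreCosh (n m : ℕ) (v : ℂ) : ℂ :=
  Complex.sinh v ^ m * aeval (Complex.cosh v) (legendreDeriv n m)

/-- The two kinds of harmonics: `+` (cosines) and `-` (sines). -/
inductive Parity
  | plus
  | minus

/-- The angular factor: `Φ_m^+(φ) = cos (m φ)`, `Φ_m^-(φ) = sin (m φ)`. -/
def angular : Parity → ℕ → ℝ → ℝ
  | .plus, m, φ => Real.cos (m * φ)
  | .minus, m, φ => Real.sin (m * φ)

/-- The azimuth `φ` of a point of `ℝ³` about the `x₀`-axis. -/
def azimuth (x : EuclideanSpace ℝ (Fin 3)) : ℝ := Complex.arg ⟨x 1, x 2⟩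

/-- `(u, v)` together with the azimuth are spheroidal coordinates of `x` for the parameter
`μ ≠ 0`. Here `0 ≤ u ≤ π`; in the prolate case `v ≥ 0` is real, and in the oblate case
`μ = iα` one has `v = w - iπ/2` with `w ≥ 0`, so that `μ cosh v = α sinh w` and
`μ sinh v = α cosh w`. -/
structure IsSpheroidalCoord (μ : ℂ) (x : EuclideanSpace ℝ (Fin 3)) (u : ℝ) (v : ℂ) : Prop where
  u_mem : u ∈ Set.Icc 0 Real.pi
  v_re : 0 ≤ v.re
  v_im : v.im = if μ.im = 0 then 0 else -(Real.pi / 2)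
  eq_zero : (x 0 : ℂ) = μ * Complex.cos u * Complex.cosh v
  eq_one : (x 1 : ℂ) = μ * Complex.sin u * Complex.sinh v * Complex.cos (azimuth x)
  eq_two : (x 2 : ℂ) = μ * Complex.sin u * Complex.sinh v * Complex.sin (azimuth x)

/-- Spheroidal coordinates `(u, v)` of the point `x`. (They are unique except, in the oblate case,
on the disk `w = 0`, where `u` and `π - u` both occur; the harmonics below take the same value
for both.) -/
def spheroidalCoord (μ : ℂ) (x : EuclideanSpace ℝ (Fin 3)) : ℝ × ℂ :=
  Classical.epsilon fun p => IsSpheroidalCoord μ x p.1 p.2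

open Classical in
/-- The solid spheroidal harmonic `U_{n,m}^±[μ]`; for `μ = 0` the solid spherical harmonic
`|x|ⁿ P_n^m(x₀/|x|) Φ_m^±(φ)`. Its values are real numbers; they are regarded as elements of `ℂ`
because the formula involves the imaginary `μ` in the oblate case. -/
def solidU (n m : ℕ) (s : Parity) (μ : ℂ) (x : EuclideanSpace ℝ (Fin 3)) : ℂ :=
  if μ = 0 then
    ((‖x‖ ^ n * assocLegendreCut n m (x 0 / ‖x‖) * angular s m (azimuth x) : ℝ) : ℂ)
  else
    ((n - m).factorial : ℂ) / (2 ^ n * (halfPoch n : ℂ)) * μ ^ n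
      * (assocLegendreCut n m (Real.cos (spheroidalCoord μ x).1) : ℂ)
      * assocLegendreCosh n m (spheroidalCoord μ x).2
      * (angular s m (azimuth x) : ℂ)

/-- The Garabedian spheroidal harmonic `V_{n,m}^±[μ] = ∂U_{n+1,m}^±[μ]/∂x₀`. -/
def solidV (n m : ℕ) (s : Parity) (μ : ℂ) (x : EuclideanSpace ℝ (Fin 3)) : ℂ :=
  lineDeriv ℝ (solidU (n + 1) m s μ) x (EuclideanSpace.single 0 1)

/-- `c` is a family of coefficients of the conversion
`V_{n,m}^±[μt] = ∑_{0 ≤ 2k ≤ n-m} c_k V_{n-2k,m}^±[μ]` on `ℝ³`, the same for both signs, extended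
by zero to the remaining `k`. -/
def IsConversion (n m : ℕ) (μt μ : ℂ) (c : ℕ → ℂ) : Prop :=
  (∀ k, n < m + 2 * k → c k = 0) ∧
  ∀ s : Parity, (s = .minus → 1 ≤ m) → ∀ x : EuclideanSpace ℝ (Fin 3),
    solidV n m s μt x =
      ∑ k ∈ Finset.range ((n - m) / 2 + 1), c k * solidV (n - 2 * k) m s μ x

/-- The conversion coefficients `v_{n,m,k}[μt, μ]`, as a family indexed by `k`. -/
def convCoeff (n m : ℕ) (μt μ : ℂ) : ℕ → ℂ :=
  Classical.epsilon (IsConversion n m μt μ)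

/-- `U_{n,m,k} = (1/2)_{n-k} (n+m-2k+1)_{2k} / ((-4)^k (1/2)_n k!)` for `0 ≤ m ≤ n`, `2k ≤ n`, and
`0` otherwise: the coefficients of `U_{n,m}[μ]` in terms of the `U_{n-2k,m}[0]`. -/
def coeffUU (n m k : ℕ) : ℚ :=
  if m ≤ n ∧ 2 * k ≤ n then
    halfPoch (n - k) * (ascPochhammer ℚ (2 * k)).eval ((n : ℚ) + m - 2 * k + 1)
      / ((-4) ^ k * halfPoch n * k.factorial)
  else 0

/-- `u_{n,m,k} = (n+m-2k+1) U_{n+1,m,k}`: the coefficients of `V_{n,m}[μ]` in terms of the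
`U_{n-2k,m}[0]`. -/
def coeffUV (n m k : ℕ) : ℚ := ((n : ℚ) + m - 2 * k + 1) * coeffUU (n + 1) m k

/-- `U⁰_{n,m,k}`, for `2k ≤ n`: the coefficients of `U_{n,m}[0]` in terms of the
`U_{n-2k,m}[μ]`. -/
def coeffUU0 (n m k : ℕ) : ℚ :=
  4 ^ (n - 2 * k) * (2 * (n : ℚ) - 4 * k + 1) * (n - k).factorial * (m + n).factorial
      * halfPoch (n - 2 * k)
    / (k.factorial * (2 * n - 2 * k + 1).factorial * (n + m - 2 * k).factorial)

/-- `u⁰_{n,m,k} = U⁰_{n+1,m,k} / (n+m+1)`: the coefficients of `U_{n,m}[0]` in terms of the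
`V_{n-2k,m}[μ]`. -/
def coeffUV0 (n m k : ℕ) : ℚ := coeffUU0 (n + 1) m k / ((n : ℚ) + m + 1)

end

end Spheroidal

/-! Write `ρ` for the distance from the `x₀`-axis and `q = ρ²`. A function `ρ^m Φ_m h(x₀, q)` is
harmonic when `h_xx + 4 q h_qq + 4 (m+1) h_q = 0`, and a polynomial solution `h` is determined by
its axis values `f(x) = h(x, 0)`, as `h = ∑ w_i f^{(2i)}(x) q^i` (`axialExt`). So relations between
harmonics reduce to relations between polynomials in one variable.

The analytic core is the product formula `mul_eval_eq_axialExt`: for `p = P_n^{(m)}`, the product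
`p(a) p(b)` is `p(1)` times the extension of `p` at `x = ab`, `q = (1-a²)(b²-1)`. Both sides satisfy
the same separated equation and agree at `b = 1`, which is a singular point, so these data suffice
(`eq_zero_of_separated`). With `a = cos u`, `b = cosh v` and a dilation by `μ`, this shows that
`U_{n,m}[μ]` is the azimuth factor times the extension of `axisPoly` (`solidU_eq`). The case `μ = 0`
comes from leading coefficients. Differentiating in `x₀` differentiates the axis polynomial
(`solidV_eq`).

On the axis, `axisPoly n m μ` is a combination of the monomials `axisPoly (n-2k) m 0` with
coefficients `coeffUU n m k * μ^(2k)`. The inverse triangular system has coefficients `coeffUU0`, by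
the telescoping identity `sum_coeffUU0_mul_coeffUU`. Composing the two gives `convUU`, polynomial in
both parameters; distinct degrees give uniqueness (`isConversion_iff`). The limits follow by
continuity, and at a zero parameter a single term of `convUU` survives. -/

namespace Spheroidal

open Polynomial

noncomputable section

/-! ### The axially symmetric Laplace equation and its separation -/

/-- The coefficients of the expansion, in powers of the squared distance from the axis, of an
axially symmetric solution of `∂²h/∂x² + 4 q ∂²h/∂q² + 4 (m + 1) ∂h/∂q = 0`. -/
def axialWeight (m i : ℕ) : ℂ := (-1) ^ i * m.factorial / (4 ^ i * i.factorial * (m + i).factorial)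

lemma axialWeight_zero (m : ℕ) : axialWeight m 0 = 1 := by
  simp [axialWeight, Nat.factorial_ne_zero]

lemma axialWeight_succ (m i : ℕ) :
    4 * ((i : ℂ) + 1) * (m + i + 1) * axialWeight m (i + 1) = -axialWeight m i := by
  have h1 : (i.factorial : ℂ) ≠ 0 := by exact_mod_cast i.factorial_ne_zero
  have h2 : ((m + i).factorial : ℂ) ≠ 0 := by exact_mod_cast (m + i).factorial_ne_zero
  have h3 : (i : ℂ) + 1 ≠ 0 := by exact_mod_cast i.succ_ne_zero
  have h4 : (m : ℂ) + i + 1 ≠ 0 := by exact_mod_cast (m + i).succ_ne_zero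
  unfold axialWeight
  rw [← add_assoc, Nat.factorial_succ, Nat.factorial_succ]
  push_cast
  field_simp
  ring

/-- The `k`-th `q`-derivative of the expansion `∑_{i < M} w_i f^{(2 i)}(x) q^i` of the axially
symmetric extension of `f^{(j)}`, in a commutative `ℂ`-algebra. -/
def axialSeries {R : Type*} [CommRing R] [Algebra ℂ R] (m M : ℕ) (f : ℂ[X]) (x q : R)
    (j k : ℕ) : R :=
  ∑ i ∈ Finset.range M, algebraMap ℂ R (axialWeight m i) * (i.descFactorial k : R)
    * aeval x (derivative^[2 * i + j] f) * q ^ (i - k)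

section Derivation

variable {R : Type*} [CommRing R] [Algebra ℂ R]

/-- The chain rule: `j` counts derivatives in `x`, `k` those in `q`. Working with an abstract
derivation keeps the separation argument purely algebraic. -/
lemma derivation_axialSeries (D : Derivation ℂ R R) (m M : ℕ) (f : ℂ[X]) (x q : R) (j k : ℕ) :
    D (axialSeries m M f x q j k) =
      D x * axialSeries m M f x q (j + 1) k + D q * axialSeries m M f x q j (k + 1) := by
  simp only [axialSeries, map_sum, Finset.mul_sum, ← Finset.sum_add_distrib]
  refine Finset.sum_congr rfl fun i _ => ?_
  rw [Derivation.leibniz, Derivation.leibniz, Derivation.leibniz, Derivation.map_aeval,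
    Derivation.leibniz_pow, Derivation.map_algebraMap, Derivation.map_natCast,
    Nat.descFactorial_succ, ← add_assoc, Function.iterate_succ_apply']
  simp only [smul_eq_mul, nsmul_eq_mul, mul_zero, add_zero]
  rw [Nat.sub_sub]
  push_cast
  ring

/-- By the recursion for the weights, the `x`-part of each term cancels the `q`-part of the next;
only the last `x`-part remains. -/
lemma axialSeries_laplace_aux (m M : ℕ) (f : ℂ[X]) (x q : R) :
    axialSeries m M f x q 2 0 + 4 * q * axialSeries m M f x q 0 2
      + 4 * ((m : R) + 1) * axialSeries m M f x q 0 1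
      = if M = 0 then 0 else algebraMap ℂ R (axialWeight m (M - 1))
          * aeval x (derivative^[2 * M] f) * q ^ (M - 1) := by
  induction M with
  | zero => simp [axialSeries]
  | succ M ih =>
    have e : ∀ j k, axialSeries m (M + 1) f x q j k = axialSeries m M f x q j k
        + algebraMap ℂ R (axialWeight m M) * (M.descFactorial k : R)
          * aeval x (derivative^[2 * M + j] f) * q ^ (M - k) := fun j k =>
      Finset.sum_range_succ _ _
    rw [e, e, e]
    cases M with
    | zero => simp [axialSeries]
    | succ N =>
      rw [if_neg (Nat.succ_ne_zero N)] at ih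
      rw [if_neg (Nat.succ_ne_zero _)]
      simp only [Nat.add_sub_cancel, Nat.descFactorial_succ, Nat.descFactorial_zero,
        Nat.sub_zero, Nat.cast_mul, Nat.cast_one, mul_one] at ih ⊢
      have hw := congrArg (algebraMap ℂ R) (axialWeight_succ m N)
      simp only [map_mul, map_add, map_natCast, map_ofNat, map_one, map_neg] at hw
      -- The truncated exponent `N - 1` is harmless at `N = 0`, where the factor `N` vanishes.
      have hq : q * ((N : R) * q ^ (N - 1)) = N * q ^ N := by
        cases N with
        | zero => simp
        | succ K => rw [Nat.add_sub_cancel]; ring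
      rw [show 2 * (N + 1 + 1) = 2 * (N + 1) + 2 by ring]
      push_cast
      simp only [add_zero]
      linear_combination ih + (algebraMap ℂ R (axialWeight m (N + 1))) * (4 * (N + 1))
          * aeval x (derivative^[2 * (N + 1)] f) * hq
          + aeval x (derivative^[2 * (N + 1)] f) * q ^ N * hw

lemma axialSeries_laplace (m M : ℕ) (f : ℂ[X]) (hf : f.natDegree < 2 * M) (x q : R) :
    axialSeries m M f x q 2 0 + 4 * q * axialSeries m M f x q 0 2
      + 4 * ((m : R) + 1) * axialSeries m M f x q 0 1 = 0 := by
  rw [axialSeries_laplace_aux, iterate_derivative_eq_zero hf]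
  simp

/-- In the coordinates `x = a b`, `q = (1 - a²) (b² - 1)` the operator
`∂²/∂x² + 4 q ∂²/∂q² + 4 (m + 1) ∂/∂q` separates. -/
lemma axialSeries_separation (Da Db : Derivation ℂ R R) (a b : R) (haa : Da a = 1)
    (hab : Da b = 0) (hba : Db a = 0) (hbb : Db b = 1) (m M : ℕ) (f : ℂ[X])
    (hf : f.natDegree < 2 * M) (h : R)
    (hh : h = axialSeries m M f (a * b) ((1 - a ^ 2) * (b ^ 2 - 1)) 0 0) :
    (1 - a ^ 2) * Da (Da h) - 2 * (m + 1) * a * Da h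
      = (1 - b ^ 2) * Db (Db h) - 2 * (m + 1) * b * Db h := by
  set x := a * b with hx
  set q := (1 - a ^ 2) * (b ^ 2 - 1) with hq
  have hax : Da x = b := by simp [hx, haa, hab]
  have hbx : Db x = a := by simp [hx, hba, hbb]
  have haq : Da q = -2 * a * (b ^ 2 - 1) := by
    simp [hq, haa, hab, Derivation.leibniz_pow]; ring
  have hbq : Db q = 2 * b * (1 - a ^ 2) := by
    simp [hq, hba, hbb, Derivation.leibniz_pow]; ring
  have h2 (D : Derivation ℂ R R) : D 2 = 0 := by exact_mod_cast D.map_natCast 2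
  have haq2 : Da (-2 * a * (b ^ 2 - 1)) = -2 * (b ^ 2 - 1) := by
    simp [haa, hab, h2, Derivation.leibniz_pow]; ring
  have hbq2 : Db (2 * b * (1 - a ^ 2)) = 2 * (1 - a ^ 2) := by
    simp [hba, hbb, h2, Derivation.leibniz_pow]; ring
  have key := axialSeries_laplace m M f hf x q
  rw [hh]
  simp only [derivation_axialSeries, hax, hbx, haq, hbq, map_add, Derivation.leibniz, smul_eq_mul,
    haq2, hbq2, hab, hba]
  simp only [zero_add, Nat.reduceAdd] at key ⊢
  -- The mixed derivatives cancel, and the two sides differ by `b² - a²` times the equation in `x`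
  -- and `q`.
  linear_combination (b ^ 2 - a ^ 2) * key

lemma product_separation (D : Derivation ℂ R R) (a c : R) (ha : D a = 1) (hc : D c = 0)
    (m : ℕ) (p : ℂ[X]) (lam : ℂ)
    (hp : (1 - X ^ 2) * derivative (derivative p) - 2 * ((m : ℂ[X]) + 1) * X * derivative p
      + C lam * p = 0) (h : R) (hh : h = c * aeval a p) :
    (1 - a ^ 2) * D (D h) - 2 * (m + 1) * a * D h = -algebraMap ℂ R lam * h := by
  have key := congrArg (aeval a) hp
  simp only [map_add, map_sub, map_mul, map_one, map_pow, aeval_X, map_ofNat, map_natCast,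
    aeval_C, map_zero] at key
  rw [hh]
  simp only [Derivation.leibniz, Derivation.map_aeval, hc, ha, smul_eq_mul, mul_one, mul_zero,
    add_zero]
  linear_combination c * key

end Derivation

/-! ### Uniqueness for the separated equation and the product formula -/

/-- The coefficientwise derivative of a polynomial with polynomial coefficients. -/
def coeffDerivation : Derivation ℂ ℂ[X][X] ℂ[X][X] :=
  PolynomialModule.equivPolynomialSelf.toLinearMap.compDer
    (derivative' (R := ℂ)).mapCoeffs

lemma coeff_coeffDerivation (F : ℂ[X][X]) (k : ℕ) :
    (coeffDerivation F).coeff k = derivative (F.coeff k) := rfl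

/-- The outer variable is `b - 1`, the inner one is `a`. Since `1 - b²` vanishes at `b = 1`,
comparing coefficients of `(b-1)^k` gives `2(k+1)(k+m+1) F_{k+1}` in terms of `F_k` alone, so no
condition on the first derivative is needed. -/
lemma eq_zero_of_separated (m : ℕ) (F : ℂ[X][X]) (h0 : F.coeff 0 = 0)
    (h : (1 - C X ^ 2) * coeffDerivation (coeffDerivation F)
        - 2 * ((m : ℂ[X][X]) + 1) * C X * coeffDerivation F
      = (1 - (X + 1) ^ 2) * derivative (derivative F)
        - 2 * ((m : ℂ[X][X]) + 1) * (X + 1) * derivative F) : F = 0 := by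
  have key : ∀ k, F.coeff k = 0 := by
    intro k
    induction k with
    | zero => exact h0
    | succ k ih =>
      have hk := congrArg (fun G => coeff G k) h
      have hC2 : (C 2 : ℂ[X][X]) = 2 := map_ofNat C 2
      have e1 : (1 - C X ^ 2) * coeffDerivation (coeffDerivation F)
        - 2 * ((m : ℂ[X][X]) + 1) * C X * coeffDerivation F
        = C (1 - X ^ 2) * coeffDerivation (coeffDerivation F)
          - C (2 * ((m : ℂ[X]) + 1) * X) * coeffDerivation F := by simp [hC2]
      have e2 : (1 - (X + 1) ^ 2) * derivative (derivative F)
        - 2 * ((m : ℂ[X][X]) + 1) * (X + 1) * derivative F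
        = -(derivative (derivative F) * X ^ 2) - C 2 * (derivative (derivative F) * X)
          - C (2 * ((m : ℂ[X]) + 1)) * (derivative F * X)
          - C (2 * ((m : ℂ[X]) + 1)) * derivative F := by
        simp [hC2]; ring
      rw [e1, e2] at hk
      simp only [coeff_sub, coeff_C_mul, coeff_coeffDerivation, ih, map_zero, mul_zero, sub_zero,
        coeff_neg] at hk
      have hA : (derivative F * X).coeff k = k * F.coeff k := by
        cases k with
        | zero => simp
        | succ k => rw [coeff_mul_X, coeff_derivative]; push_cast; ring
      have hB : (derivative (derivative F) * X).coeff k = k * (k + 1) * F.coeff (k + 1) := by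
        cases k with
        | zero => simp
        | succ k => rw [coeff_mul_X, coeff_derivative, coeff_derivative]; push_cast; ring
      have hC : (derivative (derivative F) * X ^ 2).coeff k = k * (k - 1) * F.coeff k := by
        rcases k with _ | _ | k
        · simp [pow_two, ← mul_assoc]
        · rw [pow_two, ← mul_assoc]; simp [coeff_mul_X]
        · rw [coeff_mul_X_pow, coeff_derivative, coeff_derivative]; push_cast; ring
      rw [hA, hB, hC, ih, coeff_derivative] at hk
      have : (2 * ((k : ℂ[X]) + 1) * (k + m + 1)) * F.coeff (k + 1) = 0 := by
        linear_combination hk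
      refine (mul_eq_zero.mp this).resolve_left ?_
      have : (2 * ((k : ℂ[X]) + 1) * (k + m + 1)) = ((2 * (k + 1) * (k + m + 1) : ℕ) : ℂ[X]) := by
        push_cast; ring
      rw [this]
      exact Nat.cast_ne_zero.mpr (by positivity)
  exact Polynomial.ext key

/-- The axially symmetric extension of the function `f` given on the axis. -/
def axialExt (m M : ℕ) (f : ℂ[X]) (x q : ℂ) : ℂ :=
  ∑ i ∈ Finset.range M, axialWeight m i * (derivative^[2 * i] f).eval x * q ^ i

lemma axialSeries_eq_axialExt (m M : ℕ) (f : ℂ[X]) (x q : ℂ) :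
    axialSeries m M f x q 0 0 = axialExt m M f x q := by
  simp [axialSeries, axialExt, coe_aeval_eq_eval]

lemma map_axialSeries {R S : Type*} [CommRing R] [Algebra ℂ R] [CommRing S] [Algebra ℂ S]
    (φ : R →ₐ[ℂ] S) (m M : ℕ) (f : ℂ[X]) (x q : R) (j k : ℕ) :
    φ (axialSeries m M f x q j k) = axialSeries m M f (φ x) (φ q) j k := by
  simp [axialSeries, map_sum, ← Polynomial.aeval_algHom_apply]

/-- The product formula for a polynomial solution of Gegenbauer's equation. -/
lemma mul_eval_eq_axialExt (m M : ℕ) (p : ℂ[X]) (hM : p.natDegree < 2 * M) (lam : ℂ)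
    (hp : (1 - X ^ 2) * derivative (derivative p) - 2 * ((m : ℂ[X]) + 1) * X * derivative p
      + C lam * p = 0) (a b : ℂ) :
    p.eval a * p.eval b
      = p.eval 1 * axialExt m M p (a * b) ((1 - a ^ 2) * (b ^ 2 - 1)) := by
  set a' : ℂ[X][X] := C X with ha'
  set b' : ℂ[X][X] := X + 1 with hb'
  set U : ℂ[X][X] := aeval a' p * aeval b' p with hU
  set G : ℂ[X][X] := axialSeries m M p (a' * b') ((1 - a' ^ 2) * (b' ^ 2 - 1)) 0 0 with hG
  set Da : Derivation ℂ ℂ[X][X] ℂ[X][X] := coeffDerivation with hDa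
  set Db : Derivation ℂ ℂ[X][X] ℂ[X][X] :=
    (derivative' (R := ℂ[X])).restrictScalars ℂ with hDb
  have hDbd : ∀ H : ℂ[X][X], Db H = derivative H := fun H => rfl
  have haa : Da a' = 1 := by
    ext k
    rw [hDa, coeff_coeffDerivation, ha', coeff_C, coeff_one]
    split_ifs <;> simp
  have hab : Da b' = 0 := by
    ext1 k
    rw [hDa, coeff_coeffDerivation, hb', coeff_add, coeff_X, coeff_one]
    split_ifs <;> simp
  have hba : Db a' = 0 := by simp [hDbd, ha']
  have hbb : Db b' = 1 := by simp [hDbd, hb']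
  have sepG := axialSeries_separation Da Db a' b' haa hab hba hbb m M p hM G rfl
  have sepUa := product_separation Da a' (aeval b' p) haa
    (by rw [Derivation.map_aeval, hab, smul_zero]) m p lam hp U (mul_comm _ _)
  have sepUb := product_separation Db b' (aeval a' p) hbb
    (by rw [Derivation.map_aeval, hba, smul_zero]) m p lam hp U rfl
  have hcC : ∀ (D : Derivation ℂ ℂ[X][X] ℂ[X][X]) (c : ℂ) (H : ℂ[X][X]),
      D (C (C c) * H) = C (C c) * D H := by
    intro D c H
    have : (C (C c) : ℂ[X][X]) = algebraMap ℂ _ c := rfl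
    rw [this, Derivation.leibniz, Derivation.map_algebraMap, smul_zero, add_zero, smul_eq_mul]
  have hzero : U - C (C (p.eval 1)) * G = 0 := by
    refine eq_zero_of_separated m _ ?_ ?_
    · have hφ : ∀ H : ℂ[X][X], H.coeff 0
          = ((aeval (0 : ℂ[X])).restrictScalars ℂ : ℂ[X][X] →ₐ[ℂ] ℂ[X]) H := by
        intro H
        simp [coeff_zero_eq_eval_zero, coe_aeval_eq_eval]
      rw [hφ, map_sub, map_mul, map_mul, hG, map_axialSeries, ← aeval_algHom_apply,
        ← aeval_algHom_apply]
      have h1 : ((aeval (0 : ℂ[X])).restrictScalars ℂ : ℂ[X][X] →ₐ[ℂ] ℂ[X]) a' = X := by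
        simp [ha']
      have h2 : ((aeval (0 : ℂ[X])).restrictScalars ℂ : ℂ[X][X] →ₐ[ℂ] ℂ[X]) b' = 1 := by
        simp [hb']
      have h3 : ((aeval (0 : ℂ[X])).restrictScalars ℂ : ℂ[X][X] →ₐ[ℂ] ℂ[X]) (C (C (p.eval 1)))
          = C (p.eval 1) := by simp
      have h4 : aeval (1 : ℂ[X]) p = C (p.eval 1) := by
        have := aeval_algebraMap_apply ℂ[X] (1 : ℂ) p
        simpa [coe_aeval_eq_eval] using this
      -- At `b = 1` one has `q = 0`, so only the term `i = 0` of the series survives.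
      obtain ⟨M', rfl⟩ : ∃ M', M = M' + 1 := ⟨M - 1, by omega⟩
      simp only [map_mul, map_sub, map_pow, map_one, h1, h2, h3, h4]
      rw [axialSeries, Finset.sum_range_succ', Finset.sum_eq_zero]
      · simp [axialWeight_zero]; ring
      · intro i _; simp
    · simp only [← hDbd]
      simp only [map_sub, hcC]
      linear_combination sepUa - sepUb - C (C (p.eval 1)) * sepG
  -- Specialize the outer variable to `b - 1` and the inner one to `a`.
  have hev := congrArg ((aeval a).comp ((aeval (C (b - 1) : ℂ[X])).restrictScalars ℂ) :
    ℂ[X][X] →ₐ[ℂ] ℂ) hzero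
  set ψ := ((aeval a).comp ((aeval (C (b - 1) : ℂ[X])).restrictScalars ℂ) :
    ℂ[X][X] →ₐ[ℂ] ℂ) with hψ
  have h1 : ψ a' = a := by simp [hψ, ha']
  have h2 : ψ b' = b := by simp [hψ, hb']
  have h3 : ψ (C (C (p.eval 1))) = p.eval 1 := by simp [hψ]
  rw [map_sub, map_mul, map_mul, map_zero, h3, hG, map_axialSeries, ← aeval_algHom_apply,
    ← aeval_algHom_apply] at hev
  simp only [map_mul, map_sub, map_pow, map_one, h1, h2, axialSeries_eq_axialExt,
    coe_aeval_eq_eval] at hev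
  exact sub_eq_zero.mp hev

/-- The equation is homogeneous under dilations, `x` having weight one and `q` weight two. -/
lemma axialExt_comp_C_mul_X (m M : ℕ) (f : ℂ[X]) (s x q : ℂ) :
    axialExt m M (f.comp (C s * X)) x q = axialExt m M f (s * x) (s ^ 2 * q) := by
  have h : ∀ k, derivative^[k] (f.comp (C s * X)) = C (s ^ k) * (derivative^[k] f).comp (C s * X) := by
    intro k
    induction k with
    | zero => simp
    | succ k ih =>
      rw [Function.iterate_succ_apply', Function.iterate_succ_apply', ih, derivative_C_mul,
        derivative_comp]
      simp only [derivative_C_mul, derivative_X, mul_one, pow_succ, C_mul]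
      ring
  refine Finset.sum_congr rfl fun i _ => ?_
  simp only [h, eval_mul, eval_C, eval_comp, eval_X]
  ring

lemma axialExt_C_mul (m M : ℕ) (f : ℂ[X]) (c x q : ℂ) :
    axialExt m M (C c * f) x q = c * axialExt m M f x q := by
  simp only [axialExt, iterate_derivative_C_mul, eval_mul, eval_C, Finset.mul_sum]
  exact Finset.sum_congr rfl fun i _ => by ring

lemma axialExt_sum {ι : Type*} (m M : ℕ) (t : Finset ι) (f : ι → ℂ[X]) (x q : ℂ) :
    axialExt m M (∑ j ∈ t, f j) x q = ∑ j ∈ t, axialExt m M (f j) x q := by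
  simp only [axialExt, iterate_derivative_sum, eval_finsetSum, Finset.mul_sum, Finset.sum_mul]
  exact Finset.sum_comm

/-- The homogeneous case of the product formula, read off from the leading coefficients. -/
lemma eval_eq_axialExt_X_pow (m M : ℕ) (p : ℂ[X]) (p0 : p ≠ 0) (hM : p.natDegree < 2 * M) (lam : ℂ)
    (hp : (1 - X ^ 2) * derivative (derivative p) - 2 * ((m : ℂ[X]) + 1) * X * derivative p
      + C lam * p = 0) (t : ℂ) :
    p.eval t = p.eval 1 * axialExt m M (X ^ p.natDegree) t (1 - t ^ 2) := by
  set N := p.natDegree with hN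
  -- The product formula with `a = t`, read as an identity of polynomials in `b`.
  have h1 : C (p.eval t) * p = C (p.eval 1) * ∑ i ∈ Finset.range M, C (axialWeight m i)
      * ((derivative^[2 * i] p).comp (C t * X) * (C ((1 - t ^ 2) ^ i) * (X ^ 2 - 1) ^ i)) := by
    refine Polynomial.funext fun b => ?_
    rw [eval_mul, eval_C, mul_eval_eq_axialExt m M p hM lam hp]
    simp only [axialExt, eval_mul, eval_C, eval_finsetSum, eval_comp, eval_X, eval_pow, eval_sub,
      eval_one, mul_pow]
    exact congrArg _ (Finset.sum_congr rfl fun i _ => by ring)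
  -- Compare coefficients of `b^N`. In the `i`-th term the factors have degrees at most `N - 2i` and
  -- `2i`, so only their top coefficients contribute.
  have h2 := congrArg (fun P => coeff P N) h1
  simp only [coeff_C_mul, finsetSum_coeff] at h2
  have h3 : ∀ i ∈ Finset.range M, axialWeight m i * (((derivative^[2 * i] p).comp (C t * X)
      * (C ((1 - t ^ 2) ^ i) * (X ^ 2 - 1) ^ i)).coeff N)
      = axialWeight m i * (derivative^[2 * i] (X ^ N)).eval t * (1 - t ^ 2) ^ i * p.coeff N := by
    intro i _
    rw [iterate_derivative_X_pow_eq_natCast_mul, eval_mul, eval_natCast, eval_pow, eval_X]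
    by_cases hi : 2 * i ≤ N
    · have hd : ((derivative^[2 * i] p).comp (C t * X)).natDegree ≤ N - 2 * i := by
        refine natDegree_comp_le.trans ?_
        have := natDegree_iterate_derivative p (2 * i)
        have hX : (C t * X : ℂ[X]).natDegree ≤ 1 := by simpa using natDegree_C_mul_X_pow_le t 1
        calc _ ≤ (N - 2 * i) * 1 := Nat.mul_le_mul this hX
          _ = _ := mul_one _
      have hq : (C ((1 - t ^ 2) ^ i) * (X ^ 2 - 1) ^ i : ℂ[X]).natDegree ≤ 2 * i := by
        refine (natDegree_C_mul_le _ _).trans (natDegree_pow_le.trans ?_)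
        have : (X ^ 2 - 1 : ℂ[X]).natDegree ≤ 2 := by compute_degree
        nlinarith
      have hmon : ((X ^ 2 - 1 : ℂ[X]) ^ i).coeff (2 * i) = 1 := by
        have hm : (X ^ 2 - 1 : ℂ[X]).Monic := by monicity!
        have hdeg : ((X ^ 2 - 1 : ℂ[X]) ^ i).natDegree = 2 * i := by
          rw [hm.natDegree_pow, show (X ^ 2 - 1 : ℂ[X]).natDegree = 2 by compute_degree!]; ring
        rw [← hdeg]; exact (hm.pow i).coeff_natDegree
      have := coeff_mul_add_eq_of_natDegree_le hd hq
      rw [show N - 2 * i + 2 * i = N by omega] at this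
      rw [this, comp_C_mul_X_coeff, coeff_C_mul, hmon, coeff_iterate_derivative,
        show N - 2 * i + 2 * i = N by omega, nsmul_eq_mul]
      ring
    · rw [iterate_derivative_eq_zero (by omega), Nat.descFactorial_of_lt (by omega)]
      simp
  rw [Finset.sum_congr rfl h3, ← Finset.sum_mul, ← mul_assoc] at h2
  exact mul_right_cancel₀ (leadingCoeff_ne_zero.mpr p0) h2

lemma pow_mul_eval_div_eq_axialExt (m M : ℕ) (p : ℂ[X]) (p0 : p ≠ 0) (hM : p.natDegree < 2 * M)
    (lam : ℂ)
    (hp : (1 - X ^ 2) * derivative (derivative p) - 2 * ((m : ℂ[X]) + 1) * X * derivative p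
      + C lam * p = 0) (x r : ℂ) (hr : r ≠ 0) :
    r ^ p.natDegree * p.eval (x / r)
      = p.eval 1 * axialExt m M (X ^ p.natDegree) x (r ^ 2 - x ^ 2) := by
  have h1 : (X ^ p.natDegree : ℂ[X]) = C (r ^ p.natDegree)
      * (X ^ p.natDegree : ℂ[X]).comp (C r⁻¹ * X) := by
    rw [pow_comp, X_comp, mul_pow, ← C_pow, ← mul_assoc, ← C_mul, ← mul_pow,
      mul_inv_cancel₀ hr, one_pow, C_1, one_mul]
  rw [eval_eq_axialExt_X_pow m M p p0 hM lam hp]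
  conv_rhs => rw [h1, axialExt_C_mul, axialExt_comp_C_mul_X]
  rw [show r⁻¹ * x = x / r by field_simp, show r⁻¹ ^ 2 * (r ^ 2 - x ^ 2) = 1 - (x / r) ^ 2 by
    field_simp]
  ring

/-! ### Derivatives of Legendre polynomials -/

/-- The `m`-th derivative of the Legendre polynomial `P_n`, with complex coefficients. -/
def legendreC (n m : ℕ) : ℂ[X] := (legendreDeriv n m).map (algebraMap ℚ ℂ)

lemma legendreC_eq (n m : ℕ) : legendreC n m =
    C (1 / ((2 : ℂ) ^ n * n.factorial)) * derivative^[n + m] ((X ^ 2 - 1) ^ n) := by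
  rw [legendreC, legendreDeriv, iterate_derivative_C_mul, ← Function.iterate_add_apply,
    Polynomial.map_mul, ← iterate_derivative_map, add_comm m n]
  simp

/-- `W = (X² - 1)^n` satisfies `(X² - 1) W' = 2 n X W`, a two-step recursion for its coefficients.
Rodrigues' formula multiplies these by falling factorials, which turns the recursion into
Gegenbauer's equation. -/
lemma legendreC_ode (n m : ℕ) :
    (1 - X ^ 2) * derivative (derivative (legendreC n m))
      - 2 * ((m : ℂ[X]) + 1) * X * derivative (legendreC n m)
      + C (((n : ℂ) - m) * (n + m + 1)) * legendreC n m = 0 := by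
  set W : ℂ[X] := (X ^ 2 - 1) ^ n with hW
  have hW1 : derivative W * X ^ 2 - derivative W = C (2 * (n : ℂ)) * (W * X) := by
    rw [hW]
    cases n with
    | zero => simp
    | succ n =>
      rw [derivative_pow_succ]
      simp [map_ofNat]
      ring
  have hWc : ∀ i : ℕ, ((i : ℂ) + 2) * W.coeff (i + 2) = (i - 2 * n) * W.coeff i := by
    intro i
    have h := congrArg (fun P => coeff P (i + 1)) hW1
    simp only [coeff_sub, coeff_C_mul, coeff_mul_X, coeff_derivative] at h
    have h2 : (derivative W * X ^ 2).coeff (i + 1) = i * W.coeff i := by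
      cases i with
      | zero => rw [coeff_mul_X_pow']; simp
      | succ i =>
        rw [show i + 1 + 1 = i + 2 by ring, coeff_mul_X_pow, coeff_derivative]
        push_cast
        ring
    rw [h2] at h
    push_cast at h
    linear_combination -h
  have hpc : ∀ j, (legendreC n m).coeff j
      = 1 / ((2 : ℂ) ^ n * n.factorial) * ((j + (n + m)).descFactorial (n + m) * W.coeff (j + (n + m))) := by
    intro j
    rw [legendreC_eq, coeff_C_mul, coeff_iterate_derivative, nsmul_eq_mul]
  set p := legendreC n m with hp
  have hd : ∀ j s : ℕ, ((j : ℂ) + 2) * (j + 1) * ((j + 2 + s).descFactorial s : ℂ)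
      = (j + s + 2) * (j + s + 1) * ((j + s).descFactorial s : ℂ) := by
    intro j s
    have h1 : ∀ i : ℕ, (i.factorial : ℂ) * ((i + s).descFactorial s : ℂ) = (i + s).factorial := by
      intro i
      have := Nat.factorial_mul_descFactorial (show s ≤ i + s by omega)
      rw [Nat.add_sub_cancel] at this
      exact_mod_cast this
    have h2 := h1 (j + 2)
    rw [show j + 2 + s = (j + s) + 1 + 1 by ring] at h2 ⊢
    rw [Nat.factorial_succ (j + s + 1), Nat.factorial_succ (j + s), Nat.factorial_succ (j + 1),
      Nat.factorial_succ j] at h2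
    have h3 := h1 j
    have h4 : (j.factorial : ℂ) ≠ 0 := by exact_mod_cast j.factorial_ne_zero
    push_cast at h2
    refine mul_left_cancel₀ h4 ?_
    linear_combination h2 - (j + s + 2) * (j + s + 1) * h3
  ext j
  have e : (1 - X ^ 2) * derivative (derivative p) - 2 * ((m : ℂ[X]) + 1) * X * derivative p
      + C (((n : ℂ) - m) * (n + m + 1)) * p
      = derivative (derivative p) - derivative (derivative p) * X ^ 2
        - C (2 * ((m : ℂ) + 1)) * (derivative p * X) + C (((n : ℂ) - m) * (n + m + 1)) * p := by
    simp [map_ofNat]; ring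
  have hA : (derivative p * X).coeff j = j * p.coeff j := by
    cases j with
    | zero => simp
    | succ k => rw [coeff_mul_X, coeff_derivative]; push_cast; ring
  have hC : (derivative (derivative p) * X ^ 2).coeff j = j * (j - 1) * p.coeff j := by
    rcases j with _ | _ | k
    · simp [pow_two, ← mul_assoc]
    · rw [pow_two, ← mul_assoc]; simp [coeff_mul_X]
    · rw [coeff_mul_X_pow, coeff_derivative, coeff_derivative]; push_cast; ring
  rw [e]
  simp only [coeff_add, coeff_sub, coeff_C_mul, hA, hC, coeff_derivative, hpc, coeff_zero]
  have k1 := hWc (j + (n + m))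
  have k2 := hd j (n + m)
  rw [show j + 1 + 1 + (n + m) = j + (n + m) + 2 by ring]
  rw [show j + 2 + (n + m) = j + (n + m) + 2 by ring] at k2
  push_cast at k1 k2 ⊢
  linear_combination (1 / ((2 : ℂ) ^ n * n.factorial)) * W.coeff (j + (n + m) + 2) * k2
    + (1 / ((2 : ℂ) ^ n * n.factorial)) * (j + (n + m) + 1) * ((j + (n + m)).descFactorial (n + m)) * k1

/-- `P_n^{(m)}(1)`. -/
def legendreOne (n m : ℕ) : ℚ :=
  (n + m).factorial / (2 ^ m * m.factorial * (n - m).factorial)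

lemma legendreC_eval_one (n m : ℕ) (h : m ≤ n) :
    (legendreC n m).eval 1 = (legendreOne n m : ℂ) := by
  have h1 : (derivative^[n + m] ((X ^ 2 - 1 : ℂ[X]) ^ n)).eval 1
      = (n + m).factorial * (n.choose m * 2 ^ (n - m)) := by
    rw [← factorial_smul_hasseDeriv, LinearMap.smul_apply, nsmul_eq_mul, eval_natCast_mul, ← taylor_coeff]
    congr 1
    -- Around `1`, the polynomial `X² - 1` becomes `(X + 2) X`, so the required Taylor coefficient
    -- is binomial.
    have : taylor (1 : ℂ) ((X ^ 2 - 1 : ℂ[X]) ^ n) = (X + C 2) ^ n * X ^ n := by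
      rw [← mul_pow, taylor_pow]
      congr 1
      simp [taylor_apply, map_ofNat]
      ring
    rw [this, add_comm n m, coeff_mul_X_pow, coeff_X_add_C_pow]
    ring
  rw [legendreC_eq, eval_mul, eval_C, h1, legendreOne, Nat.cast_choose ℂ h]
  obtain ⟨N, rfl⟩ := Nat.exists_eq_add_of_le h
  have a1 : (m.factorial : ℂ) ≠ 0 := by exact_mod_cast m.factorial_ne_zero
  have a2 : (N.factorial : ℂ) ≠ 0 := by exact_mod_cast N.factorial_ne_zero
  have a3 : ((m + N).factorial : ℂ) ≠ 0 := by exact_mod_cast (m + N).factorial_ne_zero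
  rw [Nat.add_sub_cancel_left]
  push_cast
  field_simp
  ring

lemma legendreC_expansion (n m : ℕ) (h : m ≤ n) :
    legendreC n m = ∑ k ∈ Finset.range ((n - m) / 2 + 1),
      C ((-1) ^ k * (n.choose k : ℂ) * ((2 * n - 2 * k).descFactorial (n + m) : ℂ)
        / (2 ^ n * n.factorial)) * X ^ (n - m - 2 * k) := by
  have h1 : (X ^ 2 - 1 : ℂ[X]) ^ n
      = ∑ k ∈ Finset.range (n + 1), C ((-1) ^ k * (n.choose k : ℂ)) * X ^ (2 * n - 2 * k) := by
    rw [sub_eq_neg_add, add_pow]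
    refine Finset.sum_congr rfl fun k hk => ?_
    rw [← pow_mul, show 2 * (n - k) = 2 * n - 2 * k by omega]
    simp
    ring
  rw [legendreC_eq, h1, iterate_derivative_sum, Finset.mul_sum]
  symm
  refine Finset.sum_subset_zero_on_sdiff (fun k hk => ?_) (fun k hk => ?_) (fun k hk => ?_)
  · simp only [Finset.mem_range] at hk ⊢; omega
  · simp only [Finset.mem_sdiff, Finset.mem_range] at hk
    rw [iterate_derivative_C_mul, iterate_derivative_X_pow_eq_natCast_mul,
      Nat.descFactorial_of_lt (by omega)]
    simp
  · rw [iterate_derivative_C_mul, iterate_derivative_X_pow_eq_natCast_mul,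
      show 2 * n - 2 * k - (n + m) = n - m - 2 * k by omega]
    rw [show ((((2 * n - 2 * k).descFactorial (n + m) : ℕ)) : ℂ[X])
      = C (((2 * n - 2 * k).descFactorial (n + m) : ℕ) : ℂ) by simp, ← mul_assoc, ← mul_assoc,
      ← C_mul, ← C_mul]
    congr 2
    ring

lemma natDegree_legendreC (n m : ℕ) (h : m ≤ n) : (legendreC n m).natDegree = n - m := by
  refine natDegree_eq_of_le_of_coeff_ne_zero ?_ ?_
  · rw [legendreC_expansion n m h]
    refine natDegree_sum_le_of_forall_le _ _ fun k _ => ?_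
    exact (natDegree_C_mul_X_pow_le _ _).trans (Nat.sub_le _ _)
  · rw [legendreC_expansion n m h, finsetSum_coeff, Finset.sum_eq_single 0]
    · rw [coeff_C_mul, Nat.mul_zero, Nat.sub_zero, Nat.sub_zero, coeff_X_pow_self]
      have : (2 * n).descFactorial (n + m) ≠ 0 := by
        rw [Ne, Nat.descFactorial_eq_zero_iff_lt]; omega
      simp [Nat.factorial_ne_zero] at this ⊢
      omega
    · intro k hk hk0
      simp only [Finset.mem_range] at hk
      rw [coeff_C_mul, coeff_X_pow, if_neg (by omega), mul_zero]
    · simp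

lemma legendreC_ne_zero (n m : ℕ) (h : m ≤ n) : legendreC n m ≠ 0 := by
  intro h0
  have := legendreC_eval_one n m h
  rw [h0, eval_zero, legendreOne] at this
  have h2 := this.symm
  simp [Nat.factorial_ne_zero] at h2

/-! ### Axis polynomials and the inversion of their expansion -/

lemma halfPoch_succ (n : ℕ) : halfPoch (n + 1) = halfPoch n * (1 / 2 + n) := by
  simp [halfPoch, ascPochhammer_succ_eval]

lemma halfPoch_eq (n : ℕ) : halfPoch n = (2 * n).factorial / (4 ^ n * n.factorial) := by
  induction n with
  | zero => simp [halfPoch]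
  | succ n ih =>
    have h : (n.factorial : ℚ) ≠ 0 := by exact_mod_cast n.factorial_ne_zero
    have h' : (n : ℚ) + 1 ≠ 0 := by positivity
    rw [halfPoch_succ, ih, show 2 * (n + 1) = 2 * n + 1 + 1 by ring, Nat.factorial_succ (2 * n + 1),
      Nat.factorial_succ (2 * n), Nat.factorial_succ n]
    push_cast
    field_simp
    ring

lemma coeffUU_eq (n m k : ℕ) (hm : m ≤ n) (hk : 2 * k ≤ n) :
    coeffUU n m k = (-1) ^ k * (2 * n - 2 * k).factorial * n.factorial * (n + m).factorial
      / (k.factorial * (n - k).factorial * (2 * n).factorial * (n + m - 2 * k).factorial) := by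
  have h1 : (ascPochhammer ℚ (2 * k)).eval ((n : ℚ) + m - 2 * k + 1)
      = (n + m).factorial / (n + m - 2 * k).factorial := by
    have e : (n : ℚ) + m - 2 * k + 1 = ((n + m - 2 * k + 1 : ℕ) : ℚ) := by
      rw [Nat.cast_add, Nat.cast_sub (by omega)]; push_cast; ring
    rw [e, ← Nat.cast_ascFactorial,
      eq_div_iff (by exact_mod_cast Nat.factorial_ne_zero _)]
    have := Nat.factorial_mul_ascFactorial (n + m - 2 * k) (2 * k)
    rw [show n + m - 2 * k + 2 * k = n + m by omega] at this
    rw [← this]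
    push_cast
    ring
  rw [coeffUU, if_pos ⟨hm, hk⟩, h1, halfPoch_eq, halfPoch_eq]
  rw [show 2 * (n - k) = 2 * n - 2 * k by omega]
  obtain ⟨r, rfl⟩ := Nat.exists_eq_add_of_le (show k ≤ n by omega)
  have f : ∀ i : ℕ, (i.factorial : ℚ) ≠ 0 := fun i => by exact_mod_cast i.factorial_ne_zero
  have f1 := f k
  have f2 := f r
  have f3 := f (2 * (k + r))
  have f4 := f (k + r + m - 2 * k)
  have f5 := f (k + r)
  rw [Nat.add_sub_cancel_left, show ((-4 : ℚ)) ^ k = (-1) ^ k * 4 ^ k by rw [← mul_pow]; norm_num,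
    pow_add]
  have s : ((-1 : ℚ) ^ k) * (-1) ^ k = 1 := by rw [← mul_pow]; norm_num
  have s0 : ((-1 : ℚ) ^ k) ≠ 0 := by positivity
  field_simp
  linear_combination (-1) * s

/-- The values on the axis of the solid harmonic `U_{n,m}[μ]`, stripped of the factor carrying
the azimuth. -/
def axisPoly (n m : ℕ) (μ : ℂ) : ℂ[X] :=
  ∑ k ∈ Finset.range ((n - m) / 2 + 1),
    C ((coeffUU n m k : ℂ) * μ ^ (2 * k) * (legendreOne (n - 2 * k) m : ℂ)) * X ^ (n - m - 2 * k)

lemma factorial_cast_ne_zero (i : ℕ) : (i.factorial : ℚ) ≠ 0 := by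
  exact_mod_cast i.factorial_ne_zero

lemma coeffUU_zero (n m : ℕ) (h : m ≤ n) : coeffUU n m 0 = 1 := by
  have := factorial_cast_ne_zero
  rw [coeffUU_eq n m 0 h (by omega)]
  simp only [Nat.mul_zero, Nat.sub_zero, Nat.factorial_zero, pow_zero]
  have h1 := this n
  have h2 := this (2 * n)
  have h3 := this (n + m)
  field_simp
  norm_num

lemma legendreOne_ne_zero (n m : ℕ) : legendreOne n m ≠ 0 := by
  have := factorial_cast_ne_zero
  have h1 := this (n + m)
  have h2 := this m
  have h3 := this (n - m)
  unfold legendreOne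
  positivity

/-- The last factor on the right is the coefficient of `X^(n-m-2k)` in `P_n^{(m)}`. This identifies
`coeffUU` with the expansion of the normalized Legendre factor. -/
lemma coeffUU_mul_legendreOne (n m k : ℕ) (h : m + 2 * k ≤ n) :
    coeffUU n m k * legendreOne (n - 2 * k) m
      = (n - m).factorial / (2 ^ n * halfPoch n) * legendreOne n m
        * ((-1) ^ k * n.choose k * (2 * n - 2 * k).descFactorial (n + m)
          / (2 ^ n * n.factorial)) := by
  have f := factorial_cast_ne_zero
  have h1 : ((2 * n - 2 * k).descFactorial (n + m) : ℚ)
      = (2 * n - 2 * k).factorial / (n - m - 2 * k).factorial := by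
    rw [eq_div_iff (f _), mul_comm]
    have := Nat.factorial_mul_descFactorial (show n + m ≤ 2 * n - 2 * k by omega)
    rw [show 2 * n - 2 * k - (n + m) = n - m - 2 * k by omega] at this
    exact_mod_cast this
  rw [coeffUU_eq n m k (by omega) (by omega), h1, legendreOne, legendreOne, halfPoch_eq,
    Nat.cast_choose ℚ (show k ≤ n by omega), show n - 2 * k + m = n + m - 2 * k by omega,
    show n - 2 * k - m = n - m - 2 * k by omega]
  have f1 := f k
  have f2 := f (n - k)
  have f3 := f (2 * n)
  have f4 := f (n + m - 2 * k)
  have f5 := f m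
  have f6 := f (n - m - 2 * k)
  have f7 := f n
  have f8 := f (n - m)
  have f9 := f (n + m)
  have e : (4 : ℚ) ^ n = 2 ^ n * 2 ^ n := by rw [← mul_pow]; norm_num
  rw [e]
  field_simp

lemma axisPoly_eq (n m : ℕ) (h : m ≤ n) (μ : ℂ) (hμ : μ ≠ 0) :
    axisPoly n m μ = C ((n - m).factorial / (2 ^ n * (halfPoch n : ℂ)) * (legendreOne n m : ℂ)
      * μ ^ (n - m)) * (legendreC n m).comp (C μ⁻¹ * X) := by
  rw [legendreC_expansion n m h, axisPoly, ← coe_compRingHom_apply, map_sum, Finset.mul_sum]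
  refine Finset.sum_congr rfl fun k hk => ?_
  simp only [Finset.mem_range] at hk
  rw [coe_compRingHom_apply, mul_comp, C_comp, pow_comp, X_comp, mul_pow, ← C_pow, ← mul_assoc, ← mul_assoc, ← C_mul,
    ← C_mul]
  congr 2
  have := congrArg (fun r : ℚ => (r : ℂ)) (coeffUU_mul_legendreOne n m k (by omega))
  push_cast at this
  have e : μ ^ (n - m) = μ ^ (2 * k) * μ ^ (n - m - 2 * k) := by
    rw [← pow_add]; congr 1; omega
  rw [mul_right_comm, this, e, inv_pow]
  field_simp

lemma axisPoly_zero (n m : ℕ) (h : m ≤ n) :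
    axisPoly n m 0 = C (legendreOne n m : ℂ) * X ^ (n - m) := by
  rw [axisPoly, Finset.sum_eq_single 0]
  · simp [coeffUU_zero n m h]
  · intro k _ hk
    rw [zero_pow (by omega)]
    simp
  · simp

lemma coeffUU0_eq (n m k : ℕ) (h : 2 * k ≤ n) :
    coeffUU0 n m k = (2 * (n : ℚ) - 4 * k + 1) * (2 * n - 4 * k).factorial * (n - k).factorial
      * (n + m).factorial
      / (k.factorial * (2 * n - 2 * k + 1).factorial * (n + m - 2 * k).factorial
        * (n - 2 * k).factorial) := by
  have f := factorial_cast_ne_zero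
  rw [coeffUU0, halfPoch_eq, show 2 * (n - 2 * k) = 2 * n - 4 * k by omega, add_comm m n]
  have f1 := f k
  have f2 := f (2 * n - 2 * k + 1)
  have f3 := f (n + m - 2 * k)
  have f4 := f (n - 2 * k)
  field_simp

/-- The two triangular systems are inverse to each other. After the common factor is removed, the
sum telescopes for `k > 0`. -/
lemma sum_coeffUU0_mul_coeffUU (n m k : ℕ) (h : m + 2 * k ≤ n) :
    ∑ j ∈ Finset.range (k + 1), coeffUU0 n m j * coeffUU (n - 2 * j) m (k - j)
      = if k = 0 then 1 else 0 := by
  have f := factorial_cast_ne_zero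
  set R : ℕ → ℚ := fun j => (n - j).factorial * (2 * n - 2 * j - 2 * k).factorial
    / ((2 * n - 2 * j + 1).factorial * (n - j - k).factorial) with hR
  -- `A` collects what does not depend on `j`, including all dependence on `m`.
  set A : ℚ := (n + m).factorial / (n + m - 2 * k).factorial with hA
  have term : ∀ j ≤ k, coeffUU0 n m j * coeffUU (n - 2 * j) m (k - j)
      = A * ((-1) ^ (k - j) * (2 * (n : ℚ) - 4 * j + 1) / (j.factorial * (k - j).factorial)
        * R j) := by
    intro j hj
    rw [coeffUU0_eq n m j (by omega), coeffUU_eq (n - 2 * j) m (k - j) (by omega) (by omega),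
      show 2 * (n - 2 * j) - 2 * (k - j) = 2 * n - 2 * j - 2 * k by omega,
      show n - 2 * j + m = n + m - 2 * j by omega,
      show n - 2 * j - (k - j) = n - j - k by omega,
      show 2 * (n - 2 * j) = 2 * n - 4 * j by omega,
      show n + m - 2 * j - 2 * (k - j) = n + m - 2 * k by omega]
    have f1 := f j
    have f2 := f (2 * n - 2 * j + 1)
    have f3 := f (n + m - 2 * j)
    have f4 := f (n - 2 * j)
    have f5 := f (k - j)
    have f6 := f (n - j - k)
    have f7 := f (2 * n - 4 * j)
    have f8 := f (n + m - 2 * k)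
    simp only [hA, hR]
    field_simp
  rcases Nat.eq_zero_or_pos k with rfl | hk
  · rw [Finset.sum_range_one, term 0 le_rfl, if_pos rfl]
    simp only [hA, hR]
    have f1 := f (n + m)
    have f2 := f n
    have f3 := f (2 * n)
    have f4 : (2 * (n : ℚ) + 1) ≠ 0 := by positivity
    simp only [Nat.mul_zero, Nat.sub_zero, Nat.factorial_succ]
    push_cast
    simp
    field_simp
  have step : ∀ J < k, (2 * (n : ℚ) - 2 * J + 1) * R J
      = (2 * (n : ℚ) - 2 * J - 2 * k - 1) * R (J + 1) := by
    intro J hJ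
    obtain ⟨a, rfl⟩ : ∃ a, n = J + 1 + k + a := ⟨n - (J + 1 + k), by omega⟩
    simp only [hR]
    rw [show J + 1 + k + a - J = k + a + 1 by omega, show J + 1 + k + a - (J + 1) = k + a by omega,
      show 2 * (J + 1 + k + a) - 2 * J - 2 * k = 2 * a + 1 + 1 by omega,
      show 2 * (J + 1 + k + a) - 2 * J = 2 * (k + a) + 1 + 1 by omega,
      show 2 * (J + 1 + k + a) - 2 * (J + 1) = 2 * (k + a) by omega,
      show k + a + 1 - k = a + 1 by omega, show k + a - k = a by omega,
      show 2 * (k + a) - 2 * k = 2 * a by omega,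
      Nat.factorial_succ (2 * (k + a) + 1 + 1), Nat.factorial_succ (2 * (k + a) + 1),
      Nat.factorial_succ (k + a),
      Nat.factorial_succ (2 * a + 1), Nat.factorial_succ (2 * a), Nat.factorial_succ a]
    have f1 := f (2 * (k + a) + 1)
    have f2 := f a
    push_cast
    field_simp
    ring
  -- The partial sums have a closed form whose factor `k - J` makes the full sum vanish; dividing by
  -- `k` is where `k > 0` enters.
  have partial_sum : ∀ J ≤ k, ∑ j ∈ Finset.range (J + 1),
      (-1) ^ (k - j) * (2 * (n : ℚ) - 4 * j + 1) / (j.factorial * (k - j).factorial) * R j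
      = (-1) ^ (k - J) * ((k : ℚ) - J) * (2 * n - 2 * J + 1)
        / (k * J.factorial * (k - J).factorial) * R J := by
    intro J
    have hk' : (k : ℚ) ≠ 0 := by positivity
    induction J with
    | zero =>
      intro _
      rw [Finset.sum_range_one]
      have f1 := f k
      simp only [Nat.sub_zero, Nat.factorial_zero, Nat.cast_zero, Nat.cast_one, mul_zero, sub_zero]
      field_simp
    | succ J ih =>
      intro hJ
      rw [Finset.sum_range_succ, ih (by omega)]
      obtain ⟨d, rfl⟩ : ∃ d, k = J + 1 + d := ⟨k - (J + 1), by omega⟩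
      have hs := step J (by omega)
      rw [show J + 1 + d - J = d + 1 by omega, Nat.add_sub_cancel_left, Nat.factorial_succ d,
        Nat.factorial_succ J]
      have f1 := f d
      have f2 := f J
      push_cast at hs hk' ⊢
      have hs' : (-1) ^ (d + 1) * ((J : ℚ) + 1 + d - J) * (2 * n - 2 * J + 1)
          / ((J + 1 + d) * J.factorial * ((d + 1) * d.factorial)) * R J
          = -(-1) ^ d / ((J + 1 + d) * J.factorial * d.factorial)
            * ((2 * (n : ℚ) - 2 * J + 1) * R J) := by
        field_simp
        ring
      rw [hs', hs]
      field_simp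
      ring
  rw [Finset.sum_congr rfl fun j hj => term j (by simp only [Finset.mem_range] at hj; omega),
    ← Finset.mul_sum, partial_sum k le_rfl, if_neg (by omega)]
  simp

lemma coeffUU0_zero (n m : ℕ) (h : m ≤ n) : coeffUU0 n m 0 = 1 := by
  have := sum_coeffUU0_mul_coeffUU n m 0 (by omega)
  simpa [coeffUU_zero n m h] using this

/-- Expand each axis polynomial and sum along the diagonals `j + l = k`; the inversion identity
leaves only `k = 0`. -/
lemma X_pow_eq_sum_axisPoly (n m : ℕ) (h : m ≤ n) (μ : ℂ) :
    C (legendreOne n m : ℂ) * X ^ (n - m) = ∑ j ∈ Finset.range ((n - m) / 2 + 1),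
      C ((coeffUU0 n m j : ℂ) * μ ^ (2 * j)) * axisPoly (n - 2 * j) m μ := by
  set K := (n - m) / 2 with hK
  set F : ℕ → ℕ → ℂ[X] := fun j l => C ((coeffUU0 n m j : ℂ) * μ ^ (2 * j))
    * (C ((coeffUU (n - 2 * j) m l : ℂ) * μ ^ (2 * l) * (legendreOne (n - 2 * j - 2 * l) m : ℂ))
      * X ^ (n - 2 * j - m - 2 * l)) with hF
  have h1 : ∀ j ∈ Finset.range (K + 1), C ((coeffUU0 n m j : ℂ) * μ ^ (2 * j))
      * axisPoly (n - 2 * j) m μ = ∑ l ∈ Finset.range (K + 1 - j), F j l := by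
    intro j hj
    simp only [Finset.mem_range] at hj
    rw [axisPoly, Finset.mul_sum, show (n - 2 * j - m) / 2 + 1 = K + 1 - j by omega]
  rw [Finset.sum_congr rfl h1, ← Finset.sum_range_diag_flip]
  have h2 : ∀ k ∈ Finset.range (K + 1), ∑ j ∈ Finset.range (k + 1), F j (k - j)
      = C (((if k = 0 then 1 else 0 : ℚ) : ℂ) * (μ ^ (2 * k) * (legendreOne (n - 2 * k) m : ℂ)))
        * X ^ (n - m - 2 * k) := by
    intro k hk
    simp only [Finset.mem_range] at hk
    rw [← sum_coeffUU0_mul_coeffUU n m k (by omega)]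
    push_cast
    rw [Finset.sum_mul, map_sum, Finset.sum_mul]
    refine Finset.sum_congr rfl fun j hj => ?_
    simp only [Finset.mem_range] at hj
    simp only [hF]
    rw [show n - 2 * j - 2 * (k - j) = n - 2 * k by omega,
      show n - 2 * j - m - 2 * (k - j) = n - m - 2 * k by omega, ← mul_assoc, ← C_mul]
    congr 2
    rw [show μ ^ (2 * k) = μ ^ (2 * j) * μ ^ (2 * (k - j)) by rw [← pow_add]; congr 1; omega]
    ring
  rw [Finset.sum_congr rfl h2, Finset.sum_eq_single 0]
  · simp
  · intro k _ hk
    simp [hk]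
  · simp

/-! ### Conversion and independence on the axis -/

/-- The conversion coefficients of the solid harmonics `U_{n,m}`. -/
def convUU (n m : ℕ) (μt μ : ℂ) (k : ℕ) : ℂ :=
  ∑ j ∈ Finset.range (k + 1), (coeffUU n m j : ℂ) * μt ^ (2 * j)
    * ((coeffUU0 (n - 2 * j) m (k - j) : ℂ) * μ ^ (2 * (k - j)))

lemma axisPoly_conversion (n m : ℕ) (h : m ≤ n) (μt μ : ℂ) :
    axisPoly n m μt = ∑ k ∈ Finset.range ((n - m) / 2 + 1),
      C (convUU n m μt μ k) * axisPoly (n - 2 * k) m μ := by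
  set K := (n - m) / 2 with hK
  set F : ℕ → ℕ → ℂ[X] := fun j l => C ((coeffUU n m j : ℂ) * μt ^ (2 * j)
    * ((coeffUU0 (n - 2 * j) m l : ℂ) * μ ^ (2 * l))) * axisPoly (n - 2 * j - 2 * l) m μ with hF
  have h1 : axisPoly n m μt = ∑ j ∈ Finset.range (K + 1), ∑ l ∈ Finset.range (K + 1 - j), F j l := by
    rw [axisPoly]
    refine Finset.sum_congr rfl fun j hj => ?_
    simp only [Finset.mem_range] at hj
    have := X_pow_eq_sum_axisPoly (n - 2 * j) m (by omega) μ
    rw [C_mul, mul_assoc, show n - m - 2 * j = n - 2 * j - m by omega, this, Finset.mul_sum,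
      show (n - 2 * j - m) / 2 + 1 = K + 1 - j by omega]
    refine Finset.sum_congr rfl fun l _ => ?_
    simp only [hF]
    rw [← mul_assoc, ← C_mul]
  rw [h1, ← Finset.sum_range_diag_flip]
  refine Finset.sum_congr rfl fun k hk => ?_
  rw [convUU, map_sum, Finset.sum_mul]
  refine Finset.sum_congr rfl fun j hj => ?_
  simp only [Finset.mem_range] at hj
  simp only [hF]
  rw [show n - 2 * j - 2 * (k - j) = n - 2 * k by omega]

lemma derivative_axisPoly_self (m : ℕ) (μ : ℂ) : derivative (axisPoly m m μ) = 0 := by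
  simp [axisPoly]

lemma derivative_axisPoly_conversion (n m : ℕ) (h : m ≤ n) (μt μ : ℂ) :
    derivative (axisPoly (n + 1) m μt) = ∑ k ∈ Finset.range ((n - m) / 2 + 1),
      C (convUU (n + 1) m μt μ k) * derivative (axisPoly (n - 2 * k + 1) m μ) := by
  rw [axisPoly_conversion (n + 1) m (by omega) μt μ, derivative_sum]
  simp only [derivative_C_mul]
  symm
  refine Finset.sum_subset_zero_on_sdiff (fun k hk => ?_) (fun k hk => ?_) (fun k hk => ?_)
  · simp only [Finset.mem_range] at hk ⊢; omega
  -- If `n + 1 - m` is even, the expansion in degree `n + 1` has one more term, the constant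
  -- `axisPoly m m μ`, which differentiation removes.
  · simp only [Finset.mem_sdiff, Finset.mem_range] at hk
    rw [show n + 1 - 2 * k = m by omega, derivative_axisPoly_self, mul_zero]
  · simp only [Finset.mem_range] at hk
    rw [show n - 2 * k + 1 = n + 1 - 2 * k by omega]

lemma natDegree_axisPoly_le (n m : ℕ) (μ : ℂ) : (axisPoly n m μ).natDegree ≤ n - m := by
  refine natDegree_sum_le_of_forall_le _ _ fun k _ => ?_
  exact (natDegree_C_mul_X_pow_le _ _).trans (Nat.sub_le _ _)

lemma coeff_axisPoly (n m : ℕ) (h : m ≤ n) (μ : ℂ) :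
    (axisPoly n m μ).coeff (n - m) = (legendreOne n m : ℂ) := by
  rw [axisPoly, finsetSum_coeff, Finset.sum_eq_single 0]
  · rw [coeff_C_mul, Nat.mul_zero, Nat.sub_zero, Nat.sub_zero, coeff_X_pow_self,
      coeffUU_zero n m h]
    simp
  · intro k hk hk0
    simp only [Finset.mem_range] at hk
    rw [coeff_C_mul, coeff_X_pow, if_neg (by omega), mul_zero]
  · simp

/-- The degrees `n - 2k - m` are distinct, so the coefficients vanish successively from the top
degree down. -/
lemma derivative_axisPoly_independent (n m : ℕ) (h : m ≤ n) (μ : ℂ) (d : ℕ → ℂ)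
    (hd : ∑ k ∈ Finset.range ((n - m) / 2 + 1),
      C (d k) * derivative (axisPoly (n - 2 * k + 1) m μ) = 0) :
    ∀ k < (n - m) / 2 + 1, d k = 0 := by
  intro k
  induction k using Nat.strong_induction_on with
  | _ k ih =>
    intro hk
    have h1 := congrArg (fun P => coeff P (n - 2 * k - m)) hd
    simp only [finsetSum_coeff, coeff_zero] at h1
    rw [Finset.sum_eq_single k] at h1
    · rw [coeff_C_mul, coeff_derivative, show n - 2 * k - m + 1 = n - 2 * k + 1 - m by omega,
        coeff_axisPoly _ _ (by omega)] at h1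
      refine (mul_eq_zero.mp h1).resolve_right (mul_ne_zero ?_ ?_)
      · exact_mod_cast legendreOne_ne_zero _ _
      · exact_mod_cast Nat.succ_ne_zero (n - 2 * k - m)
    · intro j hj hjk
      simp only [Finset.mem_range] at hj
      rcases lt_or_gt_of_ne hjk with hlt | hgt
      · rw [ih j hlt hj, C_0, zero_mul, coeff_zero]
      · rw [coeff_C_mul, coeff_eq_zero_of_natDegree_lt, mul_zero]
        have h2 := natDegree_axisPoly_le (n - 2 * j + 1) m μ
        have h3 := natDegree_derivative_le (axisPoly (n - 2 * j + 1) m μ)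
        omega
    · simp only [Finset.mem_range]
      omega

/-- A polynomial in `q` vanishing for all `q > 0` has zero constant term, which recovers the axis
values. Points on the axis itself are avoided because the azimuth factor vanishes there for `m > 0`.
-/
lemma eq_zero_of_axialExt_eq_zero (m M : ℕ) (hM : 0 < M) (P : ℂ[X])
    (h : ∀ x q : ℝ, 0 < q → axialExt m M P x q = 0) : P = 0 := by
  have inf : ∀ {s : Set ℝ}, s.Infinite → ∀ Q : ℂ[X], (∀ t ∈ s, Q.eval (t : ℂ) = 0) → Q = 0 := by
    intro s hs Q hQ
    refine Q.eq_zero_of_infinite_isRoot ?_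
    refine (hs.image Complex.ofReal_injective.injOn).mono ?_
    rintro _ ⟨t, ht, rfl⟩
    exact hQ t ht
  refine inf Set.infinite_univ P fun x _ => ?_
  have h1 := inf (Set.Ioi_infinite (0 : ℝ)) (∑ i ∈ Finset.range M,
    C (axialWeight m i * (derivative^[2 * i] P).eval (x : ℂ)) * X ^ i) fun q hq => by
      have := h x q hq
      simpa [axialExt, eval_finsetSum] using this
  have h2 := congrArg (fun Q => coeff Q 0) h1
  simp only [finsetSum_coeff, coeff_C_mul, coeff_X_pow, coeff_zero] at h2
  rw [Finset.sum_eq_single 0] at h2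
  · simpa [axialWeight_zero] using h2
  · intro i _ hi
    simp [Ne.symm hi]
  · simp [hM.ne']

/-! ### Existence of spheroidal coordinates -/

/-- The distance of a point of `ℝ³` from the `x₀`-axis. -/
def axisDist (x : EuclideanSpace ℝ (Fin 3)) : ℝ := ‖(⟨x 1, x 2⟩ : ℂ)‖

lemma axisDist_nonneg (x : EuclideanSpace ℝ (Fin 3)) : 0 ≤ axisDist x := norm_nonneg _

lemma axisDist_mul_cos (x : EuclideanSpace ℝ (Fin 3)) :
    axisDist x * Real.cos (azimuth x) = x 1 :=
  Complex.norm_mul_cos_arg _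

lemma axisDist_mul_sin (x : EuclideanSpace ℝ (Fin 3)) :
    axisDist x * Real.sin (azimuth x) = x 2 :=
  Complex.norm_mul_sin_arg _

lemma norm_sq_eq_axisDist (x : EuclideanSpace ℝ (Fin 3)) : ‖x‖ ^ 2 = x 0 ^ 2 + axisDist x ^ 2 := by
  rw [EuclideanSpace.norm_sq_eq, Fin.sum_univ_three, axisDist, Complex.sq_norm, Complex.normSq_mk]
  simp only [Real.norm_eq_abs, sq_abs]
  ring

/-- Solve `cos z = X + iρ` over `ℂ`; reflections of the real and imaginary parts of `z` put `u` and
`w` in range. -/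
lemma exists_prolate (X ρ : ℝ) (hρ : 0 ≤ ρ) : ∃ u w : ℝ, u ∈ Set.Icc 0 Real.pi ∧ 0 ≤ w ∧
    Real.cos u * Real.cosh w = X ∧ Real.sin u * Real.sinh w = ρ := by
  obtain ⟨z, hz⟩ := Complex.cos_surjective (⟨X, ρ⟩ : ℂ)
  rw [Complex.cos_eq] at hz
  have hre := congrArg Complex.re hz
  have him := congrArg Complex.im hz
  simp only [← Complex.ofReal_cos, ← Complex.ofReal_sin, ← Complex.ofReal_cosh,
    ← Complex.ofReal_sinh, ← Complex.ofReal_mul, Complex.sub_re, Complex.sub_im,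
    Complex.ofReal_re, Complex.ofReal_im, Complex.re_ofReal_mul, Complex.im_ofReal_mul,
    Complex.I_re, Complex.I_im, mul_zero, sub_zero, mul_one, zero_sub] at hre him
  refine ⟨Real.arccos (Real.cos z.re), |z.im|,
    ⟨Real.arccos_nonneg _, Real.arccos_le_pi _⟩, abs_nonneg _, ?_, ?_⟩
  · rw [Real.cos_arccos (Real.neg_one_le_cos _) (Real.cos_le_one _), Real.cosh_abs, hre]
  · rw [Real.sin_arccos, ← Real.sin_sq, Real.sqrt_sq_eq_abs, ← Real.abs_sinh,
      ← abs_mul, ← abs_neg, him, abs_of_nonneg hρ]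

/-- Solve `sin z = ρ + iX`; `ρ ≥ 0` forces `sin (Re z) ≥ 0`. -/
lemma exists_oblate (X ρ : ℝ) (hρ : 0 ≤ ρ) : ∃ u w : ℝ, u ∈ Set.Icc 0 Real.pi ∧ 0 ≤ w ∧
    Real.cos u * Real.sinh w = X ∧ Real.sin u * Real.cosh w = ρ := by
  obtain ⟨z, hz⟩ := Complex.sin_surjective (⟨ρ, X⟩ : ℂ)
  rw [Complex.sin_eq] at hz
  have hre := congrArg Complex.re hz
  have him := congrArg Complex.im hz
  simp only [← Complex.ofReal_cos, ← Complex.ofReal_sin, ← Complex.ofReal_cosh,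
    ← Complex.ofReal_sinh, ← Complex.ofReal_mul, Complex.add_re, Complex.add_im,
    Complex.ofReal_re, Complex.ofReal_im, Complex.re_ofReal_mul, Complex.im_ofReal_mul,
    Complex.I_re, Complex.I_im, mul_zero, add_zero, mul_one, zero_add] at hre him
  have hs : 0 ≤ Real.sin z.re := by
    by_contra! h
    have := mul_neg_of_neg_of_pos h (Real.cosh_pos z.im)
    linarith
  have hs' : ∀ c, c ^ 2 = Real.cos z.re ^ 2 → Real.sin (Real.arccos c) = Real.sin z.re := by
    intro c hc
    rw [Real.sin_arccos, hc, ← Real.sin_sq, Real.sqrt_sq hs]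
  have hb := Real.neg_one_le_cos z.re
  have hb' := Real.cos_le_one z.re
  rcases le_total 0 z.im with h | h
  · refine ⟨Real.arccos (Real.cos z.re), z.im,
      ⟨Real.arccos_nonneg _, Real.arccos_le_pi _⟩, h, ?_, ?_⟩
    · rw [Real.cos_arccos hb hb', him]
    · rw [hs' _ rfl, hre]
  -- A negative imaginary part is reflected together with `u ↦ π - u`, which preserves both
  -- equations.
  · refine ⟨Real.arccos (-Real.cos z.re), -z.im,
      ⟨Real.arccos_nonneg _, Real.arccos_le_pi _⟩, by linarith, ?_, ?_⟩
    · rw [Real.cos_arccos (by linarith) (by linarith), Real.sinh_neg, neg_mul_neg, him]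
    · rw [hs' _ (neg_sq _), Real.cosh_neg, hre]

lemma exists_isSpheroidalCoord (μ : ℂ) (hμ : μ ∈ params) (h0 : μ ≠ 0)
    (x : EuclideanSpace ℝ (Fin 3)) : ∃ p : ℝ × ℂ, IsSpheroidalCoord μ x p.1 p.2 := by
  have hc : (x 1 : ℂ) = axisDist x * Complex.cos (azimuth x) := by
    rw [← axisDist_mul_cos]; push_cast; rfl
  have hs : (x 2 : ℂ) = axisDist x * Complex.sin (azimuth x) := by
    rw [← axisDist_mul_sin]; push_cast; rfl
  rcases hμ with ⟨him, hre, -⟩ | ⟨hre, him⟩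
  · obtain ⟨c, rfl⟩ : ∃ c : ℝ, μ = c := ⟨μ.re, Complex.ext (by simp) (by simp [him])⟩
    have hc0 : 0 < c := lt_of_le_of_ne (by simpa using hre) (by rintro rfl; simp at h0)
    obtain ⟨u, w, hu, hw, e0, e1⟩ := exists_prolate (x 0 / c) (axisDist x / c)
      (div_nonneg (axisDist_nonneg x) hc0.le)
    have hc' : (c : ℂ) ≠ 0 := by exact_mod_cast hc0.ne'
    have e0' := congrArg (fun r : ℝ => (r : ℂ)) e0
    have e1' := congrArg (fun r : ℝ => (r : ℂ)) e1
    push_cast at e0' e1'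
    rw [eq_div_iff hc'] at e0' e1'
    refine ⟨(u, w), hu, by simpa using hw, by simp, ?_, ?_, ?_⟩
    · linear_combination -e0'
    · rw [hc]
      linear_combination -e1' * Complex.cos (azimuth x)
    · rw [hs]
      linear_combination -e1' * Complex.sin (azimuth x)
  · obtain ⟨α, rfl⟩ : ∃ α : ℝ, μ = α * Complex.I :=
      ⟨μ.im, Complex.ext (by simp [hre]) (by simp)⟩
    have hα : 0 < α := by simpa using him
    obtain ⟨u, w, hu, hw, e0, e1⟩ := exists_oblate (x 0 / α) (axisDist x / α)
      (div_nonneg (axisDist_nonneg x) hα.le)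
    have hα' : (α : ℂ) ≠ 0 := by exact_mod_cast hα.ne'
    have e0' := congrArg (fun r : ℝ => (r : ℂ)) e0
    have e1' := congrArg (fun r : ℝ => (r : ℂ)) e1
    push_cast at e0' e1'
    rw [eq_div_iff hα'] at e0' e1'
    have hcosh : Complex.cosh (w - (Real.pi / 2 : ℝ) * Complex.I)
        = -(Complex.I * Complex.sinh w) := by
      rw [Complex.cosh_sub, Complex.cosh_mul_I, Complex.sinh_mul_I, ← Complex.ofReal_cos,
        ← Complex.ofReal_sin, Real.cos_pi_div_two, Real.sin_pi_div_two]
      push_cast; ring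
    have hsinh : Complex.sinh (w - (Real.pi / 2 : ℝ) * Complex.I)
        = -(Complex.I * Complex.cosh w) := by
      rw [Complex.sinh_sub, Complex.cosh_mul_I, Complex.sinh_mul_I, ← Complex.ofReal_cos,
        ← Complex.ofReal_sin, Real.cos_pi_div_two, Real.sin_pi_div_two]
      push_cast; ring
    refine ⟨(u, w - (Real.pi / 2 : ℝ) * Complex.I), hu, ?_, ?_, ?_, ?_, ?_⟩
    · simpa using hw
    · simp [hα.ne']
    · rw [hcosh]
      linear_combination -e0' + α * Complex.cos u * Complex.sinh w * Complex.I_sq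
    · rw [hsinh, hc]
      linear_combination (-e1' + α * Complex.sin u * Complex.cosh w * Complex.I_sq)
        * Complex.cos (azimuth x)
    · rw [hsinh, hs]
      linear_combination (-e1' + α * Complex.sin u * Complex.cosh w * Complex.I_sq)
        * Complex.sin (azimuth x)

/-! ### Solid harmonics as extensions of axis polynomials -/

lemma ofReal_aeval_legendreDeriv (n m : ℕ) (t : ℝ) :
    ((aeval t (legendreDeriv n m) : ℝ) : ℂ) = (legendreC n m).eval (t : ℂ) := by
  rw [legendreC, eval_map_algebraMap]
  exact (aeval_algebraMap_apply ℂ t (legendreDeriv n m)).symm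

lemma ofReal_assocLegendreCut (n m : ℕ) (t σ : ℝ) (hσ : 0 ≤ σ) (h : σ ^ 2 = 1 - t ^ 2) :
    (assocLegendreCut n m t : ℂ) = (-1) ^ m * (σ : ℂ) ^ m * (legendreC n m).eval (t : ℂ) := by
  rw [assocLegendreCut, ← h, Real.sqrt_sq hσ, Complex.ofReal_mul, ofReal_aeval_legendreDeriv]
  push_cast
  rfl

lemma IsSpheroidalCoord.mul_sin_sinh {μ : ℂ} {x : EuclideanSpace ℝ (Fin 3)} {u : ℝ} {v : ℂ}
    (h : IsSpheroidalCoord μ x u v) :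
    μ * Complex.sin u * Complex.sinh v = (axisDist x : ℂ) := by
  have h1 := h.eq_one
  have h2 := h.eq_two
  rw [← axisDist_mul_cos] at h1
  rw [← axisDist_mul_sin] at h2
  push_cast at h1 h2
  have h3 := Complex.sin_sq_add_cos_sq (azimuth x)
  linear_combination (-Complex.cos (azimuth x)) * h1 - Complex.sin (azimuth x) * h2
    - (μ * Complex.sin u * Complex.sinh v - (axisDist x : ℂ)) * h3

/-- The part of a solid harmonic that depends on the projection along the `x₀`-axis only. -/
def azimuthFactor (m : ℕ) (s : Parity) (x : EuclideanSpace ℝ (Fin 3)) : ℂ :=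
  (-1) ^ m * (axisDist x : ℂ) ^ m * (angular s m (azimuth x) : ℂ)

/-- The product formula at `a = cos u`, `b = cosh v`, rescaled by `μ`. The right side does not
involve `(u, v)`, so the choice of coordinates on the oblate focal disk is immaterial. -/
lemma solidU_of_ne_zero (n m M : ℕ) (hmn : m ≤ n) (hM : n - m < 2 * M) (s : Parity) (μ : ℂ)
    (hμ : μ ∈ params) (h0 : μ ≠ 0) (x : EuclideanSpace ℝ (Fin 3)) :
    solidU n m s μ x
      = azimuthFactor m s x * axialExt m M (axisPoly n m μ) (x 0) ((axisDist x : ℂ) ^ 2) := by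
  have hc : IsSpheroidalCoord μ x (spheroidalCoord μ x).1 (spheroidalCoord μ x).2 :=
    Classical.epsilon_spec (exists_isSpheroidalCoord μ hμ h0 x)
  rw [solidU, if_neg h0]
  generalize (spheroidalCoord μ x).1 = u at hc ⊢
  generalize (spheroidalCoord μ x).2 = v at hc ⊢
  have hS := hc.mul_sin_sinh
  rw [ofReal_assocLegendreCut n m _ (Real.sin u)
    (Real.sin_nonneg_of_nonneg_of_le_pi hc.u_mem.1 hc.u_mem.2) (Real.sin_sq u), assocLegendreCosh,
    azimuthFactor, axisPoly_eq n m hmn μ h0, axialExt_C_mul, axialExt_comp_C_mul_X,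
    hc.eq_zero, ← hS]
  have hprod := mul_eval_eq_axialExt m M (legendreC n m)
    (by rw [natDegree_legendreC n m hmn]; exact hM) _ (legendreC_ode n m) (Complex.cos u)
    (Complex.cosh v)
  rw [legendreC_eval_one n m hmn] at hprod
  have hq : μ⁻¹ ^ 2 * (μ * Complex.sin u * Complex.sinh v) ^ 2
      = (1 - Complex.cos u ^ 2) * (Complex.cosh v ^ 2 - 1) := by
    have h1 := Complex.sin_sq_add_cos_sq u
    have h2 := Complex.cosh_sq v
    rw [h2, ← h1]
    field_simp
    ring
  have hx : μ⁻¹ * (μ * Complex.cos u * Complex.cosh v) = Complex.cos u * Complex.cosh v := by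
    field_simp
  rw [hq, hx]
  have hev : aeval (Complex.cosh v) (legendreDeriv n m)
      = (legendreC n m).eval (Complex.cosh v) := by
    rw [legendreC, eval_map_algebraMap]
  have hpow : μ ^ n = μ ^ (n - m) * μ ^ m := by rw [← pow_add]; congr 1; omega
  rw [hev, Complex.ofReal_cos, Complex.ofReal_sin, hpow]
  linear_combination ((n - m).factorial : ℂ) / (2 ^ n * (halfPoch n : ℂ)) * μ ^ (n - m) * μ ^ m
    * (-1) ^ m * Complex.sin u ^ m * Complex.sinh v ^ m * (angular s m (azimuth x) : ℂ) * hprod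

lemma solidU_zero (n m M : ℕ) (hmn : m ≤ n) (hn : 0 < n) (hM : n - m < 2 * M) (s : Parity)
    (x : EuclideanSpace ℝ (Fin 3)) :
    solidU n m s 0 x
      = azimuthFactor m s x * axialExt m M (axisPoly n m 0) (x 0) ((axisDist x : ℂ) ^ 2) := by
  rw [solidU, if_pos rfl, axisPoly_zero n m hmn, axialExt_C_mul, azimuthFactor]
  have hnorm := norm_sq_eq_axisDist x
  have hd := axisDist_nonneg x
  -- At the origin `x₀/|x|` is `0/0 = 0`; there both sides vanish because `n > 0`.
  rcases (norm_nonneg x).eq_or_lt with hr | hr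
  · rw [← hr] at hnorm ⊢
    have hd0 : axisDist x = 0 := by nlinarith [sq_nonneg (x 0)]
    have hx0 : x 0 = 0 := by nlinarith [sq_nonneg (axisDist x), sq_nonneg (x 0)]
    rw [zero_pow hn.ne', hd0, hx0]
    rcases Nat.eq_zero_or_pos m with rfl | hm
    · have : axialExt 0 M (X ^ (n - 0)) ((0 : ℝ) : ℂ) (((0 : ℝ) : ℂ) ^ 2) = 0 := by
        refine Finset.sum_eq_zero fun i _ => ?_
        cases i with
        | zero => simp [hn.ne']
        | succ i => simp
      rw [this]
      simp
    · simp [hm.ne']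
  · have hr' : (‖x‖ : ℂ) ≠ 0 := by exact_mod_cast hr.ne'
    have hnorm' : (‖x‖ : ℂ) ^ 2 - (x 0 : ℂ) ^ 2 = (axisDist x : ℂ) ^ 2 := by
      rw [sub_eq_iff_eq_add']; exact_mod_cast hnorm
    have hdeg := natDegree_legendreC n m hmn
    have key := pow_mul_eval_div_eq_axialExt m M (legendreC n m) (legendreC_ne_zero n m hmn)
      (by rw [hdeg]; exact hM) _ (legendreC_ode n m) (x 0) ‖x‖ hr'
    rw [hdeg, legendreC_eval_one n m hmn, hnorm'] at key
    rw [← key, Complex.ofReal_mul, Complex.ofReal_mul, ofReal_assocLegendreCut n m _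
      (axisDist x / ‖x‖) (by positivity) (by field_simp; linarith)]
    have hpow : (‖x‖ : ℂ) ^ n = (‖x‖ : ℂ) ^ (n - m) * (‖x‖ : ℂ) ^ m := by
      rw [← pow_add]; congr 1; omega
    push_cast
    rw [hpow, div_pow]
    field_simp

lemma solidU_eq (n m M : ℕ) (hmn : m ≤ n) (hn : 0 < n) (hM : n - m < 2 * M) (s : Parity) (μ : ℂ)
    (hμ : μ ∈ params) (x : EuclideanSpace ℝ (Fin 3)) :
    solidU n m s μ x
      = azimuthFactor m s x * axialExt m M (axisPoly n m μ) (x 0) ((axisDist x : ℂ) ^ 2) := by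
  rcases eq_or_ne μ 0 with rfl | h0
  · exact solidU_zero n m M hmn hn hM s x
  · exact solidU_of_ne_zero n m M hmn hM s μ hμ h0 x

lemma hasDerivAt_axialExt (m M : ℕ) (P : ℂ[X]) (x q : ℂ) :
    HasDerivAt (fun z => axialExt m M P z q) (axialExt m M (derivative P) x q) x := by
  have h := HasDerivAt.fun_sum (u := Finset.range M) fun i _ =>
    (((derivative^[2 * i] P).hasDerivAt x).const_mul (axialWeight m i)).mul_const (q ^ i)
  simpa only [axialExt, ← Function.iterate_succ_apply', Function.iterate_succ_apply] using h

/-- Translation along the `x₀`-axis fixes the azimuth and the distance from the axis, so only the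
axis polynomial is differentiated. -/
lemma solidV_eq (n m M : ℕ) (hmn : m ≤ n) (hM : n + 1 - m < 2 * M) (s : Parity) (μ : ℂ)
    (hμ : μ ∈ params) (x : EuclideanSpace ℝ (Fin 3)) :
    solidV n m s μ x = azimuthFactor m s x
      * axialExt m M (derivative (axisPoly (n + 1) m μ)) (x 0) ((axisDist x : ℂ) ^ 2) := by
  have h1 : ∀ t : ℝ, solidU (n + 1) m s μ (x + t • EuclideanSpace.single 0 1)
      = azimuthFactor m s x
        * axialExt m M (axisPoly (n + 1) m μ) (x 0 + (t : ℂ)) ((axisDist x : ℂ) ^ 2) := by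
    intro t
    rw [solidU_eq (n + 1) m M (by omega) (by omega) hM s μ hμ]
    simp [azimuthFactor, axisDist, azimuth]
  rw [solidV, lineDeriv]
  simp only [h1]
  refine HasDerivAt.deriv (HasDerivAt.const_mul _ ?_)
  have h2 := hasDerivAt_axialExt m M (axisPoly (n + 1) m μ) (x 0 + ((0 : ℝ) : ℂ))
    ((axisDist x : ℂ) ^ 2)
  have h3 := (h2.comp_const_add (x 0 : ℂ) ((0 : ℝ) : ℂ)).comp_ofReal
  simpa using h3

lemma isConversion_iff (n m : ℕ) (hmn : m ≤ n) (μt μ : ℂ) (hμt : μt ∈ params) (hμ : μ ∈ params)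
    (c : ℕ → ℂ) :
    IsConversion n m μt μ c ↔ c = fun k => if n < m + 2 * k then 0 else convUU (n + 1) m μt μ k := by
  have hconv := derivative_axisPoly_conversion n m hmn μt μ
  -- The cutoff `n + 2` exceeds what every degree involved requires, so one extension operator
  -- serves all terms and linearity applies.
  have hV : ∀ (s : Parity) (x : EuclideanSpace ℝ (Fin 3)) (c : ℕ → ℂ),
      ∑ k ∈ Finset.range ((n - m) / 2 + 1), c k * solidV (n - 2 * k) m s μ x
      = azimuthFactor m s x * axialExt m (n + 2) (∑ k ∈ Finset.range ((n - m) / 2 + 1),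
        C (c k) * derivative (axisPoly (n - 2 * k + 1) m μ)) (x 0) ((axisDist x : ℂ) ^ 2) := by
    intro s x c
    rw [axialExt_sum, Finset.mul_sum]
    refine Finset.sum_congr rfl fun k hk => ?_
    simp only [Finset.mem_range] at hk
    rw [solidV_eq (n - 2 * k) m (n + 2) (by omega) (by omega) s μ hμ, axialExt_C_mul]
    ring
  constructor
  · rintro ⟨hc0, hc⟩
    have hzero : ∑ k ∈ Finset.range ((n - m) / 2 + 1), C (c k - convUU (n + 1) m μt μ k)
        * derivative (axisPoly (n - 2 * k + 1) m μ) = 0 := by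
      refine eq_zero_of_axialExt_eq_zero m (n + 2) (by omega) _ fun y q hq => ?_
      -- Points of the half-plane of azimuth zero, off the axis, have a nonzero cosine factor; the
      -- sign `+` alone thus determines the coefficients.
      have h := hc Parity.plus (by simp) (!₂[y, Real.sqrt q, 0])
      rw [hV, solidV_eq n m (n + 2) hmn (by omega) _ μt hμt, hconv] at h
      have hz : (⟨Real.sqrt q, 0⟩ : ℂ) = (Real.sqrt q : ℂ) := rfl
      have hA : axisDist !₂[y, Real.sqrt q, 0] = Real.sqrt q := by
        simp [axisDist, hz, abs_of_nonneg (Real.sqrt_nonneg q)]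
      have hφ : azimuth !₂[y, Real.sqrt q, 0] = 0 := by
        simp [azimuth, hz, Complex.arg_ofReal_of_nonneg (Real.sqrt_nonneg q)]
      have hne : azimuthFactor m Parity.plus !₂[y, Real.sqrt q, 0] ≠ 0 := by
        have : Real.sqrt q ≠ 0 := (Real.sqrt_pos.mpr hq).ne'
        simp [azimuthFactor, hA, hφ, angular, this]
      have h' := mul_left_cancel₀ hne h
      have hsq : (Real.sqrt q : ℂ) ^ 2 = q := by exact_mod_cast Real.sq_sqrt hq.le
      rw [hA, hsq] at h'
      simp only [axialExt_sum, axialExt_C_mul, sub_mul, Finset.sum_sub_distrib] at h' ⊢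
      exact sub_eq_zero.mpr h'.symm
    have hd := derivative_axisPoly_independent n m hmn μ _ hzero
    funext k
    split_ifs with hk
    · exact hc0 k hk
    · exact sub_eq_zero.mp (hd k (by omega))
  · rintro rfl
    refine ⟨fun k hk => if_pos hk, fun s _ x => ?_⟩
    rw [hV, solidV_eq n m (n + 2) hmn (by omega) s μt hμt, hconv]
    congr 2
    refine Finset.sum_congr rfl fun k hk => ?_
    simp only [Finset.mem_range] at hk
    rw [if_neg (by omega)]

lemma isConversion_convCoeff (n m : ℕ) (hmn : m ≤ n) (μt μ : ℂ) (hμt : μt ∈ params)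
    (hμ : μ ∈ params) : IsConversion n m μt μ (convCoeff n m μt μ) :=
  Classical.epsilon_spec ⟨_, (isConversion_iff n m hmn μt μ hμt hμ _).mpr rfl⟩

lemma convCoeff_eq (n m : ℕ) (μt μ : ℂ) (hμt : μt ∈ params) (hμ : μ ∈ params) (k : ℕ)
    (hk : m + 2 * k ≤ n) : convCoeff n m μt μ k = convUU (n + 1) m μt μ k := by
  have h := (isConversion_iff n m (by omega) μt μ hμt hμ _).mp
    (isConversion_convCoeff n m (by omega) μt μ hμt hμ)
  rw [h]
  exact if_neg (by omega)

lemma zero_mem_params : (0 : ℂ) ∈ params := by simp [params]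

lemma convUU_zero_left (n m k : ℕ) (h : m ≤ n) (μ : ℂ) :
    convUU n m 0 μ k = (coeffUU0 n m k : ℂ) * μ ^ (2 * k) := by
  rw [convUU, Finset.sum_eq_single 0]
  · simp [coeffUU_zero n m h]
  · intro j _ hj
    simp [hj]
  · simp

lemma convUU_zero_right (n m k : ℕ) (h : m + 2 * k ≤ n) (μt : ℂ) :
    convUU n m μt 0 k = (coeffUU n m k : ℂ) * μt ^ (2 * k) := by
  rw [convUU, Finset.sum_eq_single k]
  · simp [coeffUU0_zero (n - 2 * k) m (by omega)]
  · intro j hj hjk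
    simp only [Finset.mem_range] at hj
    rw [zero_pow (by omega)]
    simp
  · simp

end

end Spheroidal

theorem mainTheorem6 (n m : ℕ) (hmn : m ≤ n) :
    -- the conversion coefficients exist and are unique
    (∀ μt ∈ Spheroidal.params, ∀ μ ∈ Spheroidal.params,
      Spheroidal.IsConversion n m μt μ (Spheroidal.convCoeff n m μt μ) ∧
      ∀ c : ℕ → ℂ, Spheroidal.IsConversion n m μt μ c → c = Spheroidal.convCoeff n m μt μ) ∧
    -- the limit as the first parameter tends to zero, and the value there
    (∀ μ ∈ Spheroidal.params, ∀ k : ℕ, m + 2 * k ≤ n →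
      Filter.Tendsto (fun μt : ℂ => Spheroidal.convCoeff n m μt μ k)
        (nhdsWithin 0 (Spheroidal.params \ {0}))
        (nhds (((n : ℂ) + m + 1) * (Spheroidal.coeffUV0 n m k : ℂ) * μ ^ (2 * k))) ∧
      Spheroidal.convCoeff n m 0 μ k
        = ((n : ℂ) + m + 1) * (Spheroidal.coeffUV0 n m k : ℂ) * μ ^ (2 * k)) ∧
    -- the limit as the second parameter tends to zero, and the value there
    (∀ μt ∈ Spheroidal.params, ∀ k : ℕ, m + 2 * k ≤ n →
      Filter.Tendsto (fun μ : ℂ => Spheroidal.convCoeff n m μt μ k)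
        (nhdsWithin 0 (Spheroidal.params \ {0}))
        (nhds ((Spheroidal.coeffUV n m k : ℂ) / ((n : ℂ) + m - 2 * k + 1) * μt ^ (2 * k))) ∧
      Spheroidal.convCoeff n m μt 0 k
        = (Spheroidal.coeffUV n m k : ℂ) / ((n : ℂ) + m - 2 * k + 1) * μt ^ (2 * k)) := by
  open Spheroidal in
  refine ⟨fun μt hμt μ hμ => ?_, fun μ hμ k hk => ?_, fun μt hμt k hk => ?_⟩
  · refine ⟨isConversion_convCoeff n m hmn μt μ hμt hμ, fun c hc => ?_⟩
    have h := isConversion_iff n m hmn μt μ hμt hμ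
    rw [(h _).mp hc, ← (h _).mp (isConversion_convCoeff n m hmn μt μ hμt hμ)]
  · have h0 : convUU (n + 1) m 0 μ k
        = ((n : ℂ) + m + 1) * (coeffUV0 n m k : ℂ) * μ ^ (2 * k) := by
      have : (n : ℂ) + m + 1 ≠ 0 := by exact_mod_cast Nat.succ_ne_zero (n + m)
      rw [convUU_zero_left (n + 1) m k (by omega), coeffUV0]
      push_cast
      field_simp
    rw [← h0]
    refine ⟨?_, convCoeff_eq n m 0 μ zero_mem_params hμ k hk⟩
    have hcont : Continuous fun μt : ℂ => convUU (n + 1) m μt μ k := by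
      unfold convUU; fun_prop
    refine ((hcont.tendsto 0).mono_left nhdsWithin_le_nhds).congr' ?_
    filter_upwards [self_mem_nhdsWithin] with μt hμt
    exact (convCoeff_eq n m μt μ hμt.1 hμ k hk).symm
  · have h0 : convUU (n + 1) m μt 0 k
        = (coeffUV n m k : ℂ) / ((n : ℂ) + m - 2 * k + 1) * μt ^ (2 * k) := by
      have : (n : ℂ) + m - 2 * k + 1 ≠ 0 := by
        have e : (n : ℂ) + m - 2 * k + 1 = ((n + m - 2 * k + 1 : ℕ) : ℂ) := by
          rw [Nat.cast_add, Nat.cast_sub (by omega)]; push_cast; ring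
        rw [e]
        exact Nat.cast_ne_zero.mpr (Nat.succ_ne_zero _)
      rw [convUU_zero_right (n + 1) m k (by omega), coeffUV]
      push_cast
      field_simp
    rw [← h0]
    refine ⟨?_, convCoeff_eq n m μt 0 hμt zero_mem_params k hk⟩
    have hcont : Continuous fun μ : ℂ => convUU (n + 1) m μt μ k := by
      unfold convUU; fun_prop
    refine ((hcont.tendsto 0).mono_left nhdsWithin_le_nhds).congr' ?_
    filter_upwards [self_mem_nhdsWithin] with μ hμ
    exact (convCoeff_eq n m μt μ hμt hμ.1 k hk).symm
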